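/- Notation. Let $A,B$ be complex $n\times n$ matrices, $\|\cdot\|$ the operator norm, and $\mathcal B_M(t)=\exp\left(it\begin{bmatrix}0&M\\M^\dagger&0\end{bmatrix}\right)$ on $\mathbb C^2\otimes\mathbb C^n$. Let $X$, $H$ (Hadamard), $S=\mathrm{diag}(1,i)$ act on the qubit $\mathbb C^2$. The following product formulas take one-parameter families of circuits (products of gates); for a negative parameter $-s$ a family is run backwards, $U(-s):=U(s)^{-1}$. (BCH) $\mathrm{BCH}_1(U,V)(t)=U(t)V(t)U(-t)V(-t)$ and, for $p\ge1$, $$\mathrm{BCH}_{p+1}(t)=\mathrm{BCH}_p(\gamma_pt)\,\mathrm{BCH}_p(-\gamma_pt)\,\mathrm{BCH}_p(\beta_pt)^{-1}\,\mathrm{BCH}_p(-\beta_pt)^{-1}\,\mathrm{BCH}_p(\gamma_pt)\,\mathrm{BCH}_p(-\gamma_pt),$$ with $\beta_p=\sqrt{2r_p}$, $\gamma_p=\sqrt{1/4+r_p}$, $r_p=\dfrac{2^{1/(p+1)}}{4(2-2^{1/(p+1)})}$. (Trotter) $\mathrm{Trotter}_2(L,R)(\lambda)=L(\lambda/2)R(\lambda/2)R(\lambda/2)L(\lambda/2)$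 and, for $k\ge2$, $$\mathrm{Trotter}_{2k}(\lambda)=\mathrm{Trotter}_{2k-2}(s_k\lambda)^2\,\mathrm{Trotter}_{2k-2}((1-4s_k)\lambda)\,\mathrm{Trotter}_{2k-2}(s_k\lambda)^2,\qquad s_k=(4-4^{1/(2k-1)})^{-1}.$$ (ADD) For real $p_A,p_B\ge1$ put $q=\max(\lceil(\min(p_A,p_B)-1)/2\rceil,1)$. Given families $\widetilde{\mathcal B}_A,\widetilde{\mathcal B}_B$, set for $\lambda\ge0$, with $\tau=\sqrt{\lambda/2}$, $$\mathrm{Left}'(\lambda)=SH\cdot\mathrm{BCH}_q(X\widetilde{\mathcal B}_BX,\ \widetilde{\mathcal B}_A)(\tau)\cdot HS^\dagger,\qquad \mathrm{Right}'(\lambda)=H\cdot\mathrm{BCH}_q(S\widetilde{\mathcal B}_AS^\dagger,\ X\widetilde{\mathcal B}_BX)(\tau)\cdot H,$$ and $\mathrm{ADD}(t)=X\cdot\mathrm{Trotter}_{2q}(\mathrm{Left}',\mathrm{Right}')(t)\cdot X$. **Theorem.** Let $p_A,p_B\ge1$ be real. (1) For every $t>0$ the circuit $\mathrm{ADD}(t)$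 uses at most $1.07\cdot30^q$ exponentials, that is, applications of $\widetilde{\mathcal B}_A$, $\widetilde{\mathcal B}_B$ or their inverses. (2) Suppose $AB=BA$ and, for some $c\ge0$, as $t\to0^+$, $$\|\widetilde{\mathcal B}_A(t)-\mathcal B_A(t)\|\in\mathcal O((ct)^{p_A}),\qquad \|\widetilde{\mathcal B}_B(t)-\mathcal B_B(t)\|\in\mathcal O((ct)^{p_B}).$$ Then $$\left\|\mathrm{ADD}(t)-\exp\left(it\begin{bmatrix}0&AB\\(AB)^\dagger&0\end{bmatrix}\right)\right\|\in\mathcal O\left((C_{TOTAL}\,t)^{\min(p_A,p_B)/2}\right),$$ where $C_{TOTAL}=\max(\|AB\|,\|BA\|,C_{BCH}^2)$ and $C_{BCH}=\max(\|A\|,\|B\|,c)$. The $\mathcal O$ is uniform, in the following sense: for every $K$ there are $K',\kappa>0$, depending only on $p_A,p_B,K$ (not on $n,A,B,c$ or the approximations), such that if the two hypotheses hold with constant $K$ for all $0<t\le t_0$, then the conclusion holds with constant $K'$ for all $t>0$ with $C_{TOTAL}\,t\le\kappa$ and $t\le\kappa t_0^2$. -/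

import Mathlib

-- The norm on complex matrices is the operator (spectral) norm induced by the Euclidean norm.
open scoped Matrix Matrix.Norms.L2Operator

namespace HybridAdder

/-! ### Block encodings

The space `ℂ² ⊗ ℂⁿ` of a qubit and a truncated mode is indexed by `Fin n ⊕ Fin n`; the first summand
carries the qubit state `|0⟩`, the second one `|1⟩`. -/

/-- Operators on `ℂ² ⊗ ℂⁿ`, as `2 × 2` block matrices with `n × n` blocks. -/
abbrev Op (n : ℕ) : Type := Matrix (Fin n ⊕ Fin n) (Fin n ⊕ Fin n) ℂ

/-- The exact block encoding `𝓑_A(t) = exp(i t [[0, A], [A†, 0]])`. -/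
noncomputable def blockEnc {n : ℕ} (A : Matrix (Fin n) (Fin n) ℂ) (t : ℝ) : Op n :=
  NormedSpace.exp ((Complex.I * (t : ℂ)) • (Matrix.fromBlocks 0 A Aᴴ 0 : Op n))

/-- The qubit gate `X`, tensored with the identity of the mode. -/
def qX (n : ℕ) : Op n := Matrix.fromBlocks 0 1 1 0

/-- The Hadamard gate `H`, tensored with the identity of the mode. -/
noncomputable def qH (n : ℕ) : Op n :=
  ((1 / Real.sqrt 2 : ℝ) : ℂ) • (Matrix.fromBlocks 1 1 1 (-1) : Op n)

/-- The phase gate `S = diag(1, i)`, tensored with the identity of the mode. -/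
noncomputable def qS (n : ℕ) : Op n := Matrix.fromBlocks 1 0 0 (Complex.I • 1)

/-! ### Circuits -/

/-- The elementary gates: the qubit gates `X`, `H`, `S`, `S†`, and the exponentials, i.e. the
(approximate) block encodings of `A` and of `B` for the time `τ`. -/
inductive Gate : Type
  | x : Gate
  | h : Gate
  | s : Gate
  | sdg : Gate
  | encA (τ : ℝ) : Gate
  | encB (τ : ℝ) : Gate

/-- A circuit is a finite product of gates; the head of the list is the leftmost factor. -/
abbrev Circuit : Type := List Gate

/-- The inverse gate. -/
def Gate.inv : Gate → Gate
  | .x => .x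
  | .h => .h
  | .s => .sdg
  | .sdg => .s
  | .encA τ => .encA (-τ)
  | .encB τ => .encB (-τ)

/-- The inverse circuit: the inverse gates in the reverse order. -/
def invCircuit (C : Circuit) : Circuit := (C.map Gate.inv).reverse

/-- Whether the gate is an exponential. -/
def Gate.isExponential : Gate → Bool
  | .encA _ => true
  | .encB _ => true
  | _ => false

/-- The number of exponentials that a circuit uses. -/
def numExponentials (C : Circuit) : ℕ := C.countP Gate.isExponential

/-- A family `U(s)`, `s > 0`, run for a time of either sign: for a negative time `-s` the operation
`U(s)` is undone, as `exp(-s M)` is the inverse of `exp(s M)`. -/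
noncomputable def runFor {n : ℕ} (U : ℝ → Op n) (s : ℝ) : Op n :=
  if 0 ≤ s then U s else (U (-s))⁻¹

/-- The operator implemented by a gate, if `UA` and `UB` are the available (approximate) block
encodings of `A` and of `B`. -/
noncomputable def Gate.eval {n : ℕ} (UA UB : ℝ → Op n) : Gate → Op n
  | .x => qX n
  | .h => qH n
  | .s => qS n
  | .sdg => (qS n)ᴴ
  | .encA τ => runFor UA τ
  | .encB τ => runFor UB τ

/-- The operator implemented by a circuit. -/
noncomputable def evalCircuit {n : ℕ} (UA UB : ℝ → Op n) (C : Circuit) : Op n :=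
  (C.map (Gate.eval UA UB)).prod

/-! ### The commutator formula `BCH_{p,1}` -/

/-- `r_p = 2^{2/(2p+2)} / (4 (2 - 2^{2/(2p+2)}))`. -/
noncomputable def bchR (p : ℕ) : ℝ :=
  (2 : ℝ) ^ (2 / (2 * (p : ℝ) + 2)) / (4 * (2 - (2 : ℝ) ^ (2 / (2 * (p : ℝ) + 2))))

/-- `β_p = (2 r_p)^{1/2}`. -/
noncomputable def bchBeta (p : ℕ) : ℝ := Real.sqrt (2 * bchR p)

/-- `γ_p = (1/4 + r_p)^{1/2}`. -/
noncomputable def bchGamma (p : ℕ) : ℝ := Real.sqrt (1 / 4 + bchR p)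

/-- The commutator product formula `BCH_{p,1}` of order `p ≥ 1`, at time `t`, for two families of
circuits `U(t) ≈ exp(t M)` and `V(t) ≈ exp(t N)`; it approximates `exp(t² [M, N])`. (The value at
`p = 0` is a placeholder and is not used.) -/
noncomputable def bch (U V : ℝ → Circuit) : ℕ → ℝ → Circuit
  | 0, _ => []
  | 1, t => U t ++ V t ++ U (-t) ++ V (-t)
  | p + 2, t =>
      bch U V (p + 1) (bchGamma (p + 1) * t) ++
      bch U V (p + 1) (-(bchGamma (p + 1) * t)) ++
      invCircuit (bch U V (p + 1) (bchBeta (p + 1) * t)) ++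
      invCircuit (bch U V (p + 1) (-(bchBeta (p + 1) * t))) ++
      bch U V (p + 1) (bchGamma (p + 1) * t) ++
      bch U V (p + 1) (-(bchGamma (p + 1) * t))

/-! ### The Trotter-Suzuki formula -/

/-- Suzuki's coefficient `p_k = 1 / (4 - 4^{1/(2k-1)})`. -/
noncomputable def suzuki (k : ℕ) : ℝ := (4 - (4 : ℝ) ^ (1 / (2 * (k : ℝ) - 1)))⁻¹

/-- `trotter L R k` is the Trotter-Suzuki formula `Trotter_{2k}`, `k ≥ 1`, for two families of
circuits `L(λ) ≈ exp(λ M)` and `R(λ) ≈ exp(λ N)`; it approximates `exp(λ (M + N))`. (The value at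
`k = 0` is a placeholder and is not used.) -/
noncomputable def trotter (L R : ℝ → Circuit) : ℕ → ℝ → Circuit
  | 0, _ => []
  | 1, l => L (l / 2) ++ R (l / 2) ++ R (l / 2) ++ L (l / 2)
  | k + 2, l =>
      trotter L R (k + 1) (suzuki (k + 2) * l) ++
      trotter L R (k + 1) (suzuki (k + 2) * l) ++
      trotter L R (k + 1) ((1 - 4 * suzuki (k + 2)) * l) ++
      trotter L R (k + 1) (suzuki (k + 2) * l) ++
      trotter L R (k + 1) (suzuki (k + 2) * l)

/-! ### The algorithm `ADD` -/

/-- The order `q = max(⌈(min(p₁, p₂) - 1) / 2⌉, 1)` of both product formulas. -/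
noncomputable def order (p₁ p₂ : ℝ) : ℕ := max ⌈(min p₁ p₂ - 1) / 2⌉₊ 1

/-- A family of circuits for positive times, extended to negative times by inverses. -/
noncomputable def signedFamily (C : ℝ → Circuit) (l : ℝ) : Circuit :=
  if 0 ≤ l then C l else invCircuit (C (-l))

/-- `Left' = S H · BCH_{q,1}(X 𝓑_B(τ) X, 𝓑_A(τ)) · H S†` with `τ = √(λ/2)`. -/
noncomputable def leftCircuit (q : ℕ) : ℝ → Circuit :=
  signedFamily fun l =>
    [Gate.s, Gate.h] ++
      bch (fun τ => [Gate.x, Gate.encB τ, Gate.x]) (fun τ => [Gate.encA τ]) q (Real.sqrt (l / 2)) ++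
      [Gate.h, Gate.sdg]

/-- `Right' = H · BCH_{q,1}(S 𝓑_A(τ) S†, X 𝓑_B(τ) X) · H` with `τ = √(λ/2)`. -/
noncomputable def rightCircuit (q : ℕ) : ℝ → Circuit :=
  signedFamily fun l =>
    [Gate.h] ++
      bch (fun τ => [Gate.s, Gate.encA τ, Gate.sdg]) (fun τ => [Gate.x, Gate.encB τ, Gate.x]) q
        (Real.sqrt (l / 2)) ++
      [Gate.h]

/-- The circuit `ADD = X · Trotter_{2q}(Left', Right') · X` at time `t`. -/
noncomputable def addCircuit (p₁ p₂ t : ℝ) : Circuit :=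
  [Gate.x] ++
    trotter (leftCircuit (order p₁ p₂)) (rightCircuit (order p₁ p₂)) (order p₁ p₂) t ++
    [Gate.x]

/-- `C_BCH = max(‖A‖, ‖B‖, c)`. -/
noncomputable def cBCH {n : ℕ} (A B : Matrix (Fin n) (Fin n) ℂ) (c : ℝ) : ℝ :=
  max ‖A‖ (max ‖B‖ c)

/-- `C_TOTAL = max(‖AB‖, ‖BA‖, C_BCH²)`. -/
noncomputable def cTotal {n : ℕ} (A B : Matrix (Fin n) (Fin n) ℂ) (c : ℝ) : ℝ :=
  max ‖A * B‖ (max ‖B * A‖ (cBCH A B c ^ 2))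

end HybridAdder

namespace HybridAdder

open Asymptotics Filter Topology

/-! ### Error expansions at zero in a normed ring -/

section Asymptotic

variable {𝔸 : Type*} [NormedRing 𝔸]

/-! Algebra. After conjugation by `X` and, on the right, by `S`, the commutators of the block
encoding generators of $A$ and $B$ are block diagonal, and $AB=BA$ makes the two blocks opposite.
Hadamard moves them off the diagonal again. One half-commutator carries $AB-(AB)^\dagger$, the other
$AB+(AB)^\dagger$; their sum, conjugated by `X`, is exactly the generator for $AB$
(`conjSkew_leftGen_add_rightGen`). So ADD is a Trotter formula whose two factors are commutator
formulas.

Order. `isBigO_commutatorFormula` and `isBigO_suzukiFormula` go by induction. Each lower-order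
formula is an exact exponential plus a leading error; leading errors simply add in a product
(`ExpandsTo.mul`), and the coefficients of the recursion are chosen so that they cancel.

Uniformity. These are qualitative statements about fixed elements of an arbitrary Banach algebra.
`exists_uniform_bound` applies them once, in the $\ell^\infty$ product of all the matrix algebras
over all pairs of contractions. The formulas commute with the coordinate homomorphisms, so one
constant serves every dimension and every generator; rescaling time handles generators of norm at
most $C$.

Assembly. Put $r=C_{BCH}\sqrt t$. The product formulas cost $O(r^{2q+1})$ (`exists_exact_bound`).
The number of gates depends only on $q$ and every exponential runs for a nonzero time $O(\sqrt t)$,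
so the inexact gates cost $O(r^{\min(p_A,p_B)})$ (`norm_evalCircuit_sub_le`). Finally
$\min(p_A,p_B)\le 2q+1$ and $r^2\le C_{TOTAL}t$. -/

theorem isBigO_pow_of_le {E : Type*} [Norm E] {f : ℝ → E} {m n : ℕ} (hmn : m ≤ n)
    (hf : f =O[𝓝 0] fun t : ℝ => t ^ n) : f =O[𝓝 0] fun t : ℝ => t ^ m := by
  refine hf.trans (IsBigO.of_bound 1 ?_)
  filter_upwards [Metric.ball_mem_nhds (0 : ℝ) one_pos] with t ht
  have : |t| ≤ 1 := by simpa using (mem_ball_zero_iff.1 ht).le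
  simpa using pow_le_pow_of_le_one (abs_nonneg t) this hmn

theorem isBigO_comp_mul {E : Type*} [Norm E] {f : ℝ → E} {n : ℕ} (c : ℝ)
    (hf : f =O[𝓝 0] fun t : ℝ => t ^ n) :
    (fun t => f (c * t)) =O[𝓝 0] fun t : ℝ => t ^ n := by
  have h : Tendsto (fun t : ℝ => c * t) (𝓝 0) (𝓝 0) := by
    simpa using (continuous_const_mul c).tendsto (0 : ℝ)
  refine (hf.comp_tendsto h).trans ?_
  simpa [Function.comp_def, mul_pow] using
    (isBigO_refl (fun t : ℝ => t ^ n) (𝓝 0)).const_mul_left (c ^ n)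

theorem isBigO_pow_mul {f g : ℝ → 𝔸} {m n : ℕ}
    (hf : f =O[𝓝 0] fun t : ℝ => t ^ m) (hg : g =O[𝓝 0] fun t : ℝ => t ^ n) :
    (fun t => f t * g t) =O[𝓝 0] fun t : ℝ => t ^ (m + n) := by
  simpa [pow_add] using hf.mul hg

theorem isBigO_pow_zero_of_continuousAt {E : Type*} [NormedAddCommGroup E] {f : ℝ → E}
    (hf : ContinuousAt f 0) : f =O[𝓝 0] fun t : ℝ => t ^ 0 := by
  simpa using hf.tendsto.isBigO_one ℝ

theorem isBigO_pow_smul {E : Type*} [NormedAddCommGroup E] [NormedSpace ℝ E] {f : ℝ → E} (n : ℕ)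
    (hf : ContinuousAt f 0) : (fun t => t ^ n • f t) =O[𝓝 0] fun t : ℝ => t ^ n := by
  simpa using (isBigO_refl (fun t : ℝ => t ^ n) (𝓝 0)).smul (hf.tendsto.isBigO_one ℝ)

/-- An analytic function which is `O(tⁿ)` is divisible by `tⁿ`. -/
theorem exists_eq_pow_smul_of_isBigO {E : Type*} [NormedAddCommGroup E] [NormedSpace ℝ E]
    {f : ℝ → E} (hf : AnalyticAt ℝ f 0) (n : ℕ) (hn : f =O[𝓝 0] fun t : ℝ => t ^ n) :
    ∃ g : ℝ → E, AnalyticAt ℝ g 0 ∧ ∀ᶠ t in 𝓝 0, f t = t ^ n • g t := by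
  induction n with
  | zero => exact ⟨f, hf, by simp⟩
  | succ n ih =>
    obtain ⟨g, hg, hfg⟩ := ih (isBigO_pow_of_le n.le_succ hn)
    have hg0 : g 0 = 0 := by
      obtain ⟨C, hC⟩ := hn.bound
      have h1 : ∀ᶠ t in 𝓝[≠] (0 : ℝ), ‖g t‖ ≤ C * |t| := by
        filter_upwards [hfg.filter_mono nhdsWithin_le_nhds, hC.filter_mono nhdsWithin_le_nhds,
          self_mem_nhdsWithin] with t h1 h2 h3
        rw [h1, norm_smul, norm_pow, norm_pow, Real.norm_eq_abs, pow_succ] at h2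
        have h4 : 0 < |t| ^ n := pow_pos (abs_pos.2 h3) n
        refine le_of_mul_le_mul_left (h2.trans_eq (by ring)) h4
      have h2 : Tendsto (fun t => ‖g t‖) (𝓝[≠] (0 : ℝ)) (𝓝 ‖g 0‖) :=
        hg.continuousAt.norm.tendsto.mono_left nhdsWithin_le_nhds
      have h3 : Tendsto (fun t : ℝ => C * |t|) (𝓝[≠] (0 : ℝ)) (𝓝 0) := by
        have : Continuous fun t : ℝ => C * |t| := by fun_prop
        simpa using (this.tendsto 0).mono_left nhdsWithin_le_nhds
      exact norm_le_zero_iff.1 (le_of_tendsto_of_tendsto h2 h3 h1)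
    have h1 : ((1 : ℕ) : ℕ∞) ≤ analyticOrderAt g 0 := by
      rw [Nat.cast_one, Order.one_le_iff_ne_zero, hg.analyticOrderAt_ne_zero]
      exact hg0
    obtain ⟨g', hg', h⟩ := (natCast_le_analyticOrderAt hg).1 h1
    refine ⟨g', hg', ?_⟩
    filter_upwards [hfg, h] with t h1 h2
    rw [h1, h2, smul_smul]
    simp [pow_succ]

/-- Isolates the leading Taylor coefficient of an error. The value of `F` never matters: the
recursions cancel it whatever it is. -/
theorem exists_isBigO_sub_pow_smul {E : Type*} [NormedAddCommGroup E] [NormedSpace ℝ E]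
    {f : ℝ → E} (hf : AnalyticAt ℝ f 0) (n : ℕ) (hn : f =O[𝓝 0] fun t : ℝ => t ^ n) :
    ∃ F : E, (fun t => f t - t ^ n • F) =O[𝓝 0] fun t : ℝ => t ^ (n + 1) := by
  obtain ⟨g, hg, h⟩ := exists_eq_pow_smul_of_isBigO hf n hn
  refine ⟨g 0, ?_⟩
  have h1 : (fun t => g t - g 0) =O[𝓝 0] fun t : ℝ => t := by
    simpa using hg.differentiableAt.isBigO_sub
  refine ((isBigO_refl (fun t : ℝ => t ^ n) (𝓝 0)).smul h1).congr' ?_ ?_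
  · filter_upwards [h] with t ht
    rw [ht, smul_sub]
  · exact Eventually.of_forall fun t => by simp [pow_succ]

/-- `f = e + y + O(t^(N + d))`, where `e = 1 + O(t^d)` and `y = O(t^N)`. -/
structure ExpandsTo (N d : ℕ) (f e y : ℝ → 𝔸) : Prop where
  base : (fun t => e t - 1) =O[𝓝 0] fun t : ℝ => t ^ d
  corr : y =O[𝓝 0] fun t : ℝ => t ^ N
  rem : (fun t => f t - e t - y t) =O[𝓝 0] fun t : ℝ => t ^ (N + d)

namespace ExpandsTo

variable {N d : ℕ} {f f₁ f₂ e e₁ e₂ y y₁ y₂ : ℝ → 𝔸}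

theorem base_bounded (h : ExpandsTo N d f e y) : e =O[𝓝 0] fun t : ℝ => t ^ 0 := by
  have := (isBigO_pow_of_le (Nat.zero_le d) h.base).add
    (isBigO_pow_zero_of_continuousAt (f := fun _ : ℝ => (1 : 𝔸)) continuousAt_const)
  simpa using this

theorem bounded (h : ExpandsTo N d f e y) : f =O[𝓝 0] fun t : ℝ => t ^ 0 := by
  have := ((isBigO_pow_of_le (Nat.zero_le _) h.rem).add
    (isBigO_pow_of_le (Nat.zero_le _) h.corr)).add h.base_bounded
  simpa using this

/-- The factors `e` are $1+O(t^d)$, so multiplying a correction by one of them changes it by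
$O(t^{N+d})$ only, and the product of two corrections is $O(t^{2N})$, negligible because $d\le N$.
Hence corrections add, although the ring is noncommutative. -/
theorem mul (hd : d ≤ N) (h₁ : ExpandsTo N d f₁ e₁ y₁) (h₂ : ExpandsTo N d f₂ e₂ y₂) :
    ExpandsTo N d (fun t => f₁ t * f₂ t) (fun t => e₁ t * e₂ t) (fun t => y₁ t + y₂ t) where
  base := by
    refine ((isBigO_pow_mul h₁.base h₂.base_bounded).add h₂.base).congr_left fun t => ?_
    noncomm_ring
  corr := h₁.corr.add h₂.corr
  rem := by
    have h3 : (fun t => e₁ t + y₁ t) =O[𝓝 0] fun t : ℝ => t ^ 0 :=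
      h₁.base_bounded.add (isBigO_pow_of_le (Nat.zero_le _) h₁.corr)
    have a := isBigO_pow_mul h₁.rem h₂.bounded
    have b := isBigO_pow_mul h3 h₂.rem
    rw [zero_add] at b
    have c := isBigO_pow_mul h₁.base h₂.corr
    rw [add_comm d] at c
    have c' := isBigO_pow_mul h₁.corr h₂.base
    have c'' := isBigO_pow_of_le (Nat.add_le_add_left hd N) (isBigO_pow_mul h₁.corr h₂.corr)
    refine ((((a.add b).add c).add c').add c'').congr_left fun t => ?_
    noncomm_ring

theorem inv (hd : d ≤ N) (h : ExpandsTo N d f e y) {f' e' : ℝ → 𝔸} (hf : ∀ t, f' t * f t = 1)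
    (hf' : f' =O[𝓝 0] fun t : ℝ => t ^ 0) (he : ∀ t, e t * e' t = 1)
    (he' : (fun t => e' t - 1) =O[𝓝 0] fun t : ℝ => t ^ d) :
    ExpandsTo N d f' e' (fun t => -y t) where
  base := he'
  corr := h.corr.neg_left
  rem := by
    have he0 : e' =O[𝓝 0] fun t : ℝ => t ^ 0 := by
      have := (isBigO_pow_of_le (Nat.zero_le d) he').add
        (isBigO_pow_zero_of_continuousAt (f := fun _ : ℝ => (1 : 𝔸)) continuousAt_const)
      simpa using this
    have a := isBigO_pow_mul h.corr he'
    have b := isBigO_pow_mul h.base h.corr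
    rw [add_comm d] at b
    have c := isBigO_pow_mul h.rem he0
    have c' := isBigO_pow_of_le (Nat.add_le_add_left hd N) (isBigO_pow_mul h.corr h.corr)
    have c'' := isBigO_pow_of_le (Nat.le_add_right _ _) (isBigO_pow_mul h.rem h.corr)
    have key := isBigO_pow_mul hf' ((((b.sub a).sub c).add c').add c'')
    rw [zero_add] at key
    refine key.congr_left fun t => ?_
    -- Pulling out the bounded factor `f'` on the left leaves a bracket in which only `f`, `e'` and
    -- `y` occur; since $ee'=1$, it is a sum of products each of order $t^{N+d}$.
    have : f' t - e' t - -y t = f' t * (1 - f t * e' t + f t * y t) := by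
      rw [mul_add, mul_sub, ← mul_assoc, ← mul_assoc, hf]; simp
    have h2 : (e t - 1) * y t - y t * (e' t - 1) - (f t - e t - y t) * e' t + y t * y t +
        (f t - e t - y t) * y t = e t * e' t - f t * e' t + f t * y t := by noncomm_ring
    rw [this, h2, he]

theorem comp_mul (c : ℝ) (h : ExpandsTo N d f e y) :
    ExpandsTo N d (fun t => f (c * t)) (fun t => e (c * t)) (fun t => y (c * t)) where
  base := isBigO_comp_mul c h.base
  corr := isBigO_comp_mul c h.corr
  rem := isBigO_comp_mul c h.rem

end ExpandsTo

variable [NormedAlgebra ℝ 𝔸]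

/-- A family of units which is analytic at `0` together with its inverse. -/
structure AnalyticUnit (u : ℝ → 𝔸ˣ) : Prop where
  val : AnalyticAt ℝ (fun t => (u t : 𝔸)) 0
  inv_val : AnalyticAt ℝ (fun t => ((u t)⁻¹.val : 𝔸)) 0

namespace AnalyticUnit

variable {u v : ℝ → 𝔸ˣ}

theorem mul (hu : AnalyticUnit u) (hv : AnalyticUnit v) : AnalyticUnit fun t => u t * v t where
  val := by
    simp only [Units.val_mul]
    exact hu.val.mul hv.val
  inv_val := by
    simp only [mul_inv_rev, Units.val_mul]
    exact hv.inv_val.mul hu.inv_val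

theorem inv (hu : AnalyticUnit u) : AnalyticUnit fun t => (u t)⁻¹ where
  val := hu.inv_val
  inv_val := by simpa using hu.val

theorem comp_mul (hu : AnalyticUnit u) (c : ℝ) : AnalyticUnit fun t => u (c * t) where
  val := AnalyticAt.comp_of_eq (g := fun t => (u t : 𝔸)) (f := fun t => c * t) hu.val
    (by fun_prop) (by simp)
  inv_val := AnalyticAt.comp_of_eq (g := fun t => ((u t)⁻¹.val : 𝔸)) (f := fun t => c * t) hu.inv_val
    (by fun_prop) (by simp)

theorem comp_neg_mul (hu : AnalyticUnit u) (c : ℝ) : AnalyticUnit fun t => u (-(c * t)) := by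
  simpa using hu.comp_mul (-c)

end AnalyticUnit

end Asymptotic

/-! ### One-parameter groups in a Banach algebra -/

section Exponential

variable {𝔸 : Type*} [NormedRing 𝔸] [NormedAlgebra ℝ 𝔸] [CompleteSpace 𝔸]

theorem exp_add_smul (M : 𝔸) (s t : ℝ) :
    NormedSpace.exp ((s + t) • M) = NormedSpace.exp (s • M) * NormedSpace.exp (t • M) := by
  let +nondep : NormedAlgebra ℚ 𝔸 := .restrictScalars ℚ ℝ 𝔸
  rw [add_smul, NormedSpace.exp_add_of_commute]
  exact ((Commute.refl M).smul_left s).smul_right t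

/-- The one-parameter group `t ↦ exp(t M)`. -/
noncomputable def expUnit (M : 𝔸) (t : ℝ) : 𝔸ˣ where
  val := NormedSpace.exp (t • M)
  inv := NormedSpace.exp ((-t) • M)
  val_inv := by rw [← exp_add_smul]; simp
  inv_val := by rw [← exp_add_smul]; simp

@[simp] theorem coe_expUnit (M : 𝔸) (t : ℝ) : (expUnit M t : 𝔸) = NormedSpace.exp (t • M) := rfl

theorem expUnit_neg (M : 𝔸) (t : ℝ) : expUnit M (-t) = (expUnit M t)⁻¹ := Units.ext rfl

theorem analyticAt_exp_smul (M : 𝔸) (s : ℝ) :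
    AnalyticAt ℝ (fun t : ℝ => NormedSpace.exp (t • M)) s := by
  refine AnalyticAt.comp (g := NormedSpace.exp) (f := fun t : ℝ => t • M)
    (NormedSpace.exp_analytic _) ?_
  exact analyticAt_id.smul analyticAt_const

theorem analyticUnit_expUnit (M : 𝔸) : AnalyticUnit (expUnit M) where
  val := analyticAt_exp_smul M 0
  inv_val := by
    simp only [← expUnit_neg, coe_expUnit]
    exact AnalyticAt.comp_of_eq (g := fun t : ℝ => NormedSpace.exp (t • M)) (f := fun t => -t)
      (analyticAt_exp_smul M 0) (by fun_prop) (by simp)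

theorem isBigO_exp_smul_sub_one (M : 𝔸) :
    (fun t : ℝ => NormedSpace.exp (t • M) - 1) =O[𝓝 0] fun t : ℝ => t ^ 1 := by
  simpa [NormedSpace.exp_zero] using (analyticAt_exp_smul M 0).differentiableAt.isBigO_sub

theorem isBigO_exp_sq_smul_sub_one (M : 𝔸) :
    (fun t : ℝ => NormedSpace.exp (t ^ 2 • M) - 1) =O[𝓝 0] fun t : ℝ => t ^ 2 := by
  have h : Tendsto (fun t : ℝ => t ^ 2) (𝓝 0) (𝓝 0) := by
    simpa using (continuous_pow 2).tendsto (0 : ℝ)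
  simpa [Function.comp_def] using (isBigO_exp_smul_sub_one M).comp_tendsto h

theorem isBigO_exp_smul_sub_partialSum (M : 𝔸) (n : ℕ) :
    (fun t : ℝ => NormedSpace.exp (t • M) -
      ∑ k ∈ Finset.range n, ((k.factorial : ℝ)⁻¹ * t ^ k) • M ^ k) =O[𝓝 0] fun t : ℝ => t ^ n := by
  have h0 := (NormedSpace.exp_hasFPowerSeriesAt_zero (𝕂 := ℝ) (𝔸 := 𝔸)).isBigO_sub_partialSum_pow n
  have h : Tendsto (fun t : ℝ => t • M) (𝓝 0) (𝓝 0) := by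
    have : Continuous fun t : ℝ => t • M := by fun_prop
    simpa using this.tendsto 0
  refine ((h0.comp_tendsto h).congr_left fun t => ?_).trans ?_
  · simp only [Function.comp_def, zero_add, FormalMultilinearSeries.partialSum,
      NormedSpace.expSeries_apply_eq, smul_pow, smul_smul]
  · refine IsBigO.of_bound (‖M‖ ^ n) (Eventually.of_forall fun t => ?_)
    simp [norm_smul, mul_pow, mul_comm]

theorem isBigO_exp_smul_sub_one_sub (M : 𝔸) :
    (fun t : ℝ => NormedSpace.exp (t • M) - 1 - t • M) =O[𝓝 0] fun t : ℝ => t ^ 2 := by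
  refine (isBigO_exp_smul_sub_partialSum M 2).congr_left fun t => ?_
  simp [Finset.sum_range_succ, sub_sub]

theorem isBigO_exp_smul_sub_quadratic (M : 𝔸) :
    (fun t : ℝ => NormedSpace.exp (t • M) - (1 + t • M + t ^ 2 • ((2 : ℝ)⁻¹ • M ^ 2)))
      =O[𝓝 0] fun t : ℝ => t ^ 3 := by
  refine (isBigO_exp_smul_sub_partialSum M 3).congr_left fun t => ?_
  simp [Finset.sum_range_succ, smul_smul, mul_comm]

end Exponential

end HybridAdder

namespace HybridAdder

open Asymptotics Filter Topology

/-! ### The product formulas in an abstract group -/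

section Formulas

variable {G G' : Type*} [Group G] [Group G']

/-- The commutator formula `bch`, for families of elements of a group. -/
noncomputable def commutatorFormula (U V : ℝ → G) : ℕ → ℝ → G
  | 0, _ => 1
  | 1, t => U t * V t * U (-t) * V (-t)
  | p + 2, t =>
      commutatorFormula U V (p + 1) (bchGamma (p + 1) * t) *
      commutatorFormula U V (p + 1) (-(bchGamma (p + 1) * t)) *
      (commutatorFormula U V (p + 1) (bchBeta (p + 1) * t))⁻¹ *
      (commutatorFormula U V (p + 1) (-(bchBeta (p + 1) * t)))⁻¹ *
      commutatorFormula U V (p + 1) (bchGamma (p + 1) * t) *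
      commutatorFormula U V (p + 1) (-(bchGamma (p + 1) * t))

/-- The Trotter-Suzuki formula `trotter`, for families of elements of a group. -/
noncomputable def suzukiFormula (L R : ℝ → G) : ℕ → ℝ → G
  | 0, _ => 1
  | 1, l => L (l / 2) * R (l / 2) * R (l / 2) * L (l / 2)
  | k + 2, l =>
      suzukiFormula L R (k + 1) (suzuki (k + 2) * l) *
      suzukiFormula L R (k + 1) (suzuki (k + 2) * l) *
      suzukiFormula L R (k + 1) ((1 - 4 * suzuki (k + 2)) * l) *
      suzukiFormula L R (k + 1) (suzuki (k + 2) * l) *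
      suzukiFormula L R (k + 1) (suzuki (k + 2) * l)

/-- Naturality is what carries estimates from the $\ell^\infty$ product to its coordinates, and
passes between unitaries and units. -/
theorem map_commutatorFormula (φ : G →* G') (U V : ℝ → G) (p : ℕ) (t : ℝ) :
    φ (commutatorFormula U V p t) = commutatorFormula (fun s => φ (U s)) (fun s => φ (V s)) p t := by
  induction p, t using commutatorFormula.induct with
  | case1 t => simp [commutatorFormula]
  | case2 t => simp [commutatorFormula]
  | case3 t p ih1 ih2 ih3 ih4 => simp [commutatorFormula, ih1, ih2, ih3, ih4]

theorem map_suzukiFormula (φ : G →* G') (L R : ℝ → G) (k : ℕ) (l : ℝ) :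
    φ (suzukiFormula L R k l) = suzukiFormula (fun s => φ (L s)) (fun s => φ (R s)) k l := by
  induction k, l using suzukiFormula.induct with
  | case1 l => simp [suzukiFormula]
  | case2 l => simp [suzukiFormula]
  | case3 l k ih1 ih2 => simp [suzukiFormula, ih1, ih2]

theorem commutatorFormula_comp_mul (U V : ℝ → G) (c : ℝ) (p : ℕ) (t : ℝ) :
    commutatorFormula (fun s => U (c * s)) (fun s => V (c * s)) p t
      = commutatorFormula U V p (c * t) := by
  induction p, t using commutatorFormula.induct with
  | case1 t => simp [commutatorFormula]
  | case2 t => simp [commutatorFormula]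
  | case3 t p ih1 ih2 ih3 ih4 =>
    simp only [commutatorFormula, ih1, ih2, ih3, ih4, mul_neg, mul_left_comm c]

theorem suzukiFormula_comp_mul (L R : ℝ → G) (c : ℝ) (k : ℕ) (l : ℝ) :
    suzukiFormula (fun s => L (c * s)) (fun s => R (c * s)) k l = suzukiFormula L R k (c * l) := by
  induction k, l using suzukiFormula.induct with
  | case1 l => simp [suzukiFormula]
  | case2 l => simp [suzukiFormula, mul_div_assoc]
  | case3 l k ih1 ih2 => simp only [suzukiFormula, ih1, ih2, mul_left_comm c]

theorem suzukiFormula_neg {L R : ℝ → G} (hL : ∀ l, L (-l) = (L l)⁻¹) (hR : ∀ l, R (-l) = (R l)⁻¹)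
    (k : ℕ) (l : ℝ) : suzukiFormula L R k (-l) = (suzukiFormula L R k l)⁻¹ := by
  induction k, l using suzukiFormula.induct with
  | case1 l => simp [suzukiFormula]
  | case2 l => simp [suzukiFormula, neg_div, hL, hR, mul_assoc]
  | case3 l k ih1 ih2 => simp [suzukiFormula, ih1, ih2, mul_neg, mul_assoc]

end Formulas

/-! ### Identities between the coefficients -/

section Coefficients

theorem bchR_pos (p : ℕ) (hp : 1 ≤ p) : 0 < bchR p := by
  have hp' : (1 : ℝ) ≤ p := by exact_mod_cast hp
  have h : (2 : ℝ) ^ (2 / (2 * (p : ℝ) + 2)) < 2 := by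
    conv_rhs => rw [← Real.rpow_one 2]
    apply Real.rpow_lt_rpow_of_exponent_lt one_lt_two
    rw [div_lt_one (by positivity)]
    linarith
  unfold bchR
  have : 0 < 2 - (2 : ℝ) ^ (2 / (2 * (p : ℝ) + 2)) := by linarith
  positivity

theorem bchBeta_pos (p : ℕ) (hp : 1 ≤ p) : 0 < bchBeta p :=
  Real.sqrt_pos.2 (by have := bchR_pos p hp; positivity)

theorem bchGamma_pos (p : ℕ) (hp : 1 ≤ p) : 0 < bchGamma p :=
  Real.sqrt_pos.2 (by have := bchR_pos p hp; positivity)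

theorem bchBeta_sq (p : ℕ) (hp : 1 ≤ p) : bchBeta p ^ 2 = 2 * bchR p :=
  Real.sq_sqrt (by have := bchR_pos p hp; positivity)

theorem bchGamma_sq (p : ℕ) (hp : 1 ≤ p) : bchGamma p ^ 2 = 1 / 4 + bchR p :=
  Real.sq_sqrt (by have := bchR_pos p hp; positivity)

/-- `bchR` is chosen so that $\beta_p^2/\gamma_p^2=2^{1/(p+1)}$; raise this to the power $p+1$. -/
theorem bchBeta_pow (p : ℕ) (hp : 1 ≤ p) :
    bchBeta p ^ (2 * p + 2) = 2 * bchGamma p ^ (2 * p + 2) := by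
  have hp' : (1 : ℝ) ≤ p := by exact_mod_cast hp
  have h : (2 : ℝ) ^ (2 / (2 * (p : ℝ) + 2)) < 2 := by
    conv_rhs => rw [← Real.rpow_one 2]
    apply Real.rpow_lt_rpow_of_exponent_lt one_lt_two
    rw [div_lt_one (by positivity)]
    linarith
  have h2 : ((2 : ℝ) ^ (2 / (2 * (p : ℝ) + 2))) ^ (p + 1) = 2 := by
    rw [← Real.rpow_natCast, ← Real.rpow_mul (by norm_num)]
    convert Real.rpow_one 2 using 2
    push_cast
    field_simp
  have h3 : 2 * bchR p = (2 : ℝ) ^ (2 / (2 * (p : ℝ) + 2)) * (1 / 4 + bchR p) := by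
    unfold bchR
    generalize (2 : ℝ) ^ (2 / (2 * (p : ℝ) + 2)) = x at h
    have : 2 - x ≠ 0 := by linarith
    field_simp
    ring
  have h4 : 2 * p + 2 = 2 * (p + 1) := by ring
  rw [h4, pow_mul, pow_mul, bchBeta_sq p hp, bchGamma_sq p hp, h3, mul_pow, h2]

theorem four_rpow_lt (k : ℕ) (hk : 2 ≤ k) : (4 : ℝ) ^ (1 / (2 * (k : ℝ) - 1)) < 4 := by
  have hk' : (2 : ℝ) ≤ k := by exact_mod_cast hk
  conv_rhs => rw [← Real.rpow_one 4]
  apply Real.rpow_lt_rpow_of_exponent_lt (by norm_num)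
  rw [div_lt_one (by linarith)]
  linarith

theorem suzuki_pos (k : ℕ) (hk : 2 ≤ k) : 0 < suzuki k :=
  inv_pos.2 (by linarith [four_rpow_lt k hk])

theorem one_sub_four_mul_suzuki (k : ℕ) (hk : 2 ≤ k) :
    1 - 4 * suzuki k = -((4 : ℝ) ^ (1 / (2 * (k : ℝ) - 1)) * suzuki k) := by
  have : 4 - (4 : ℝ) ^ (1 / (2 * (k : ℝ) - 1)) ≠ 0 := by linarith [four_rpow_lt k hk]
  unfold suzuki
  field_simp
  ring

theorem one_sub_four_mul_suzuki_neg (k : ℕ) (hk : 2 ≤ k) : 1 - 4 * suzuki k < 0 := by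
  rw [one_sub_four_mul_suzuki k hk]
  have := suzuki_pos k hk
  have : 0 < (4 : ℝ) ^ (1 / (2 * (k : ℝ) - 1)) * suzuki k := by positivity
  linarith

theorem suzuki_pow (k : ℕ) :
    4 * suzuki (k + 2) ^ (2 * k + 3) + (1 - 4 * suzuki (k + 2)) ^ (2 * k + 3) = 0 := by
  have h2 : ((4 : ℝ) ^ (1 / (2 * ((k + 2 : ℕ) : ℝ) - 1))) ^ (2 * k + 3) = 4 := by
    rw [← Real.rpow_natCast, ← Real.rpow_mul (by norm_num)]
    convert Real.rpow_one 4 using 2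
    push_cast
    have : (2 * ((k : ℝ) + 2) - 1) ≠ 0 := by
      have : (0 : ℝ) ≤ k := Nat.cast_nonneg k
      linarith
    field_simp
    ring
  have h3 : Odd (2 * k + 3) := ⟨k + 1, by ring⟩
  rw [one_sub_four_mul_suzuki (k + 2) (by omega), h3.neg_pow, mul_pow, h2]
  ring

end Coefficients

/-! ### Orders of the commutator and Trotter-Suzuki formulas -/

section Order

variable {𝔸 : Type*} [NormedRing 𝔸]

theorem isBigO_sub_mul {f₁ f₂ g₁ g₂ : ℝ → 𝔸} {n : ℕ}
    (hf : (fun t => f₁ t - g₁ t) =O[𝓝 0] fun t : ℝ => t ^ n)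
    (hg : (fun t => f₂ t - g₂ t) =O[𝓝 0] fun t : ℝ => t ^ n) (h₁ : ContinuousAt f₁ 0)
    (h₂ : ContinuousAt g₂ 0) :
    (fun t => f₁ t * f₂ t - g₁ t * g₂ t) =O[𝓝 0] fun t : ℝ => t ^ n := by
  have a := isBigO_pow_mul (isBigO_pow_zero_of_continuousAt h₁) hg
  have b := isBigO_pow_mul hf (isBigO_pow_zero_of_continuousAt h₂)
  rw [zero_add] at a
  refine (a.add b).congr_left fun t => ?_
  noncomm_ring

variable [NormedAlgebra ℝ 𝔸]

theorem analyticUnit_commutatorFormula {U V : ℝ → 𝔸ˣ} (hU : AnalyticUnit U) (hV : AnalyticUnit V) :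
    ∀ p, AnalyticUnit (commutatorFormula U V (p + 1))
  | 0 => by
    have h1 := hU.comp_mul (-1)
    have h2 := hV.comp_mul (-1)
    simp only [neg_mul, one_mul] at h1 h2
    exact ((hU.mul hV).mul h1).mul h2
  | p + 1 => by
    have ih := analyticUnit_commutatorFormula hU hV p
    exact (((((ih.comp_mul _).mul (ih.comp_neg_mul _)).mul (ih.comp_mul _).inv).mul
      (ih.comp_neg_mul _).inv).mul (ih.comp_mul _)).mul (ih.comp_neg_mul _)

theorem analyticUnit_suzukiFormula {L R : ℝ → 𝔸ˣ} (hL : AnalyticUnit L) (hR : AnalyticUnit R) :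
    ∀ k, AnalyticUnit (suzukiFormula L R (k + 1))
  | 0 => by
    have h1 := hL.comp_mul 2⁻¹
    have h2 := hR.comp_mul 2⁻¹
    simp only [inv_mul_eq_div] at h1 h2
    exact ((h1.mul h2).mul h2).mul h1
  | k + 1 => by
    have ih := analyticUnit_suzukiFormula hL hR k
    exact ((((ih.comp_mul _).mul (ih.comp_mul _)).mul (ih.comp_mul _)).mul (ih.comp_mul _)).mul
      (ih.comp_mul _)

variable [CompleteSpace 𝔸]

theorem isBigO_commutatorFormula_one (M N : 𝔸) :
    (fun t : ℝ => (commutatorFormula (expUnit M) (expUnit N) 1 t).val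
      - NormedSpace.exp (t ^ 2 • (M * N - N * M))) =O[𝓝 0] fun t : ℝ => t ^ 3 := by
  set M₂ : 𝔸 := (2 : ℝ)⁻¹ • M ^ 2
  set N₂ : 𝔸 := (2 : ℝ)⁻¹ • N ^ 2
  set C := M * N - N * M
  have cM := (analyticAt_exp_smul M 0).continuousAt
  have cN := (analyticAt_exp_smul N 0).continuousAt
  have cC : ContinuousAt (fun t : ℝ => NormedSpace.exp (t ^ 2 • C)) 0 :=
    ContinuousAt.comp_of_eq (g := fun t : ℝ => NormedSpace.exp (t • C)) (f := fun t : ℝ => t ^ 2)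
      (analyticAt_exp_smul C 0).continuousAt (by fun_prop) (by simp)
  have hM := isBigO_exp_smul_sub_quadratic M
  have hN := isBigO_exp_smul_sub_quadratic N
  have hC : (fun t : ℝ => NormedSpace.exp (t ^ 2 • C) - (1 + t ^ 2 • C)) =O[𝓝 0]
      fun t : ℝ => t ^ 3 := by
    have h : Tendsto (fun t : ℝ => t ^ 2) (𝓝 0) (𝓝 0) := by
      simpa using (continuous_pow 2).tendsto (0 : ℝ)
    have h1 := (isBigO_exp_smul_sub_one_sub C).comp_tendsto h
    refine isBigO_pow_of_le (n := 4) (by norm_num) (h1.congr (fun t => ?_) fun t => ?_)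
    · simp [sub_sub]
    · simp [← pow_mul]
  have h1 := isBigO_sub_mul hM hN cM (by fun_prop)
  have h2 := isBigO_sub_mul hC (isBigO_sub_mul hN hM cN (by fun_prop)) cC (by fun_prop)
  have h3 : (fun t : ℝ => (1 + t • M + t ^ 2 • M₂) * (1 + t • N + t ^ 2 • N₂)
      - (1 + t ^ 2 • C) * ((1 + t • N + t ^ 2 • N₂) * (1 + t • M + t ^ 2 • M₂))) =O[𝓝 0]
      fun t : ℝ => t ^ 3 := by
    refine (isBigO_pow_smul (n := 3) (f := fun t : ℝ => M * N₂ + M₂ * N - N * M₂ - N₂ * M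
      + t • (M₂ * N₂ - N₂ * M₂) - C * (M + N + t • (M₂ + N₂ + N * M) + t ^ 2 • (N * M₂ + N₂ * M)
      + t ^ 3 • (N₂ * M₂))) (by fun_prop)).congr_left fun t => ?_
    simp only [mul_add, add_mul, smul_add, smul_sub, sub_mul, smul_mul_assoc,
      mul_smul_comm, smul_smul, one_mul, mul_one, C]
    module
  -- Comparing $UV$ with $e^{t^2C}VU$ avoids expanding inverses: quadratic Taylor polynomials
  -- suffice, and the bounded factor $(VU)^{-1}$ is multiplied in afterwards.
  have key : (fun t => ((expUnit M t * expUnit N t : 𝔸ˣ) : 𝔸) - NormedSpace.exp (t ^ 2 • C) *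
      ((expUnit N t * expUnit M t : 𝔸ˣ) : 𝔸)) =O[𝓝 0] fun t : ℝ => t ^ 3 := by
    refine ((h1.sub h2).add h3).congr_left fun t => ?_
    simp only [Units.val_mul, coe_expUnit]
    abel
  have hinv : ContinuousAt (fun t : ℝ => (((expUnit M t)⁻¹ * (expUnit N t)⁻¹ : 𝔸ˣ) : 𝔸)) 0 := by
    simp only [Units.val_mul]
    exact ((analyticUnit_expUnit M).inv_val.mul (analyticUnit_expUnit N).inv_val).continuousAt
  refine (isBigO_pow_mul key (isBigO_pow_zero_of_continuousAt hinv)).congr_left fun t => ?_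
  have e : (expUnit N t * expUnit M t) * ((expUnit M t)⁻¹ * (expUnit N t)⁻¹) = 1 := by group
  rw [sub_mul, mul_assoc (NormedSpace.exp _), ← Units.val_mul, ← Units.val_mul, e]
  simp only [commutatorFormula, expUnit_neg, Units.val_one, mul_one, mul_assoc]

/-- The commutator formula of order `p` agrees with `exp(t² [M, N])` up to `O(t^(2p+1))`. -/
theorem isBigO_commutatorFormula (M N : 𝔸) (p : ℕ) :
    (fun t : ℝ => (commutatorFormula (expUnit M) (expUnit N) (p + 1) t).val
      - NormedSpace.exp (t ^ 2 • (M * N - N * M))) =O[𝓝 0] fun t : ℝ => t ^ (2 * p + 3) := by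
  induction p with
  | zero => exact isBigO_commutatorFormula_one M N
  | succ p ih =>
    set C := M * N - N * M
    set W := commutatorFormula (expUnit M) (expUnit N) (p + 1) with hW
    have hWa : AnalyticUnit W :=
      analyticUnit_commutatorFormula (analyticUnit_expUnit M) (analyticUnit_expUnit N) p
    have hE : AnalyticAt ℝ (fun t : ℝ => NormedSpace.exp (t ^ 2 • C)) 0 :=
      AnalyticAt.comp_of_eq (g := fun t : ℝ => NormedSpace.exp (t • C)) (f := fun t : ℝ => t ^ 2)
        (analyticAt_exp_smul C 0) (by fun_prop) (by simp)
    -- Two error coefficients are extracted because one recursion step gains two orders: the bases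
    -- $e^{\pm t^2C}$ are $1+O(t^2)$, so `ExpandsTo` applies with $d=2$.
    obtain ⟨F₁, hF₁⟩ := exists_isBigO_sub_pow_smul (hWa.val.sub hE) (2 * p + 3) ih
    have hA : AnalyticAt ℝ (fun t : ℝ => t ^ (2 * p + 3) • F₁) 0 :=
      (analyticAt_id.pow _).smul analyticAt_const
    obtain ⟨F₂, hF₂⟩ := exists_isBigO_sub_pow_smul ((hWa.val.sub hE).sub hA) (2 * p + 4) hF₁
    set y : ℝ → 𝔸 := fun t => t ^ (2 * p + 3) • F₁ + t ^ (2 * p + 4) • F₂ with hy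
    have hX : ExpandsTo (2 * p + 3) 2 (fun t => (W t).val)
        (fun t : ℝ => NormedSpace.exp (t ^ 2 • C)) y := by
      refine ⟨isBigO_exp_sq_smul_sub_one C, (isBigO_pow_smul _ continuousAt_const).add
        (isBigO_pow_of_le (by omega) (isBigO_pow_smul (2 * p + 4) continuousAt_const)), ?_⟩
      exact hF₂.congr_left fun t => by simp [hy, sub_sub, add_assoc]
    have hXi : ExpandsTo (2 * p + 3) 2 (fun t => (W t)⁻¹.val)
        (fun t : ℝ => NormedSpace.exp (-t ^ 2 • C)) (fun t => -y t) :=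
      hX.inv (by omega) (fun t => Units.inv_mul _)
        (isBigO_pow_zero_of_continuousAt hWa.inv_val.continuousAt)
        (fun t => by rw [← exp_add_smul]; simp)
        (by simpa using isBigO_exp_sq_smul_sub_one (-C))
    have hd : 2 ≤ 2 * p + 3 := by omega
    set γ := bchGamma (p + 1)
    set β := bchBeta (p + 1)
    have key := ((((((hX.comp_mul γ).mul hd (hX.comp_mul (-γ))).mul hd (hXi.comp_mul β)).mul hd
      (hXi.comp_mul (-β))).mul hd (hX.comp_mul γ)).mul hd (hX.comp_mul (-γ))).rem
    refine key.congr_left fun t => ?_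
    have hγβ : 4 * γ ^ 2 - 2 * β ^ 2 = 1 := by
      rw [bchGamma_sq _ (by omega), bchBeta_sq _ (by omega)]; ring
    have hpow : β ^ (2 * p + 4) = 2 * γ ^ (2 * p + 4) := bchBeta_pow (p + 1) (by omega)
    have hodd : Odd (2 * p + 3) := ⟨p + 1, by ring⟩
    have heven : Even (2 * p + 4) := ⟨p + 2, by ring⟩
    -- The odd term cancels between the times $\pm\gamma t$ and $\pm\beta t$; the even one because
    -- $4\gamma^{2p+4}-2\beta^{2p+4}=0$, the inverse factors contributing the minus sign.
    have hyz : y (γ * t) + y (-γ * t) + -y (β * t) + -y (-β * t) + y (γ * t) + y (-γ * t) = 0 := by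
      simp only [hy, neg_mul, hodd.neg_pow, heven.neg_pow, mul_pow, hpow]
      module
    rw [hyz, sub_zero]
    simp only [← exp_add_smul]
    congr 1
    · simp only [commutatorFormula, neg_mul, Units.val_mul, hW]
      rfl
    · congr 2
      linear_combination t ^ 2 * hγβ

/-- Both `S` and the exponential satisfy $S(l)S(-l)=1$, so the leading errors at $l$ and $-l$ must
cancel to the next order; for even $m$ they are equal, hence negligible. -/
theorem isBigO_succ_of_symmetric {S : ℝ → 𝔸ˣ} (hS : AnalyticUnit S) (hneg : ∀ l, S (-l) = (S l)⁻¹)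
    (Z : 𝔸) {m : ℕ} (hm : 1 ≤ m) (heven : Even m)
    (h : (fun l : ℝ => (S l).val - NormedSpace.exp (l • Z)) =O[𝓝 0] fun l : ℝ => l ^ m) :
    (fun l : ℝ => (S l).val - NormedSpace.exp (l • Z)) =O[𝓝 0] fun l : ℝ => l ^ (m + 1) := by
  obtain ⟨F, hF⟩ := exists_isBigO_sub_pow_smul (hS.val.sub (analyticAt_exp_smul Z 0)) m h
  have hX : ExpandsTo m 1 (fun l => (S l).val) (fun l : ℝ => NormedSpace.exp (l • Z))
      (fun l => l ^ m • F) :=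
    ⟨isBigO_exp_smul_sub_one Z, isBigO_pow_smul m continuousAt_const, hF⟩
  have h1 := (hX.mul hm (hX.comp_mul (-1))).rem
  have h2 : (fun l : ℝ => l ^ m • F) =O[𝓝 0] fun l : ℝ => l ^ (m + 1) := by
    refine (h1.const_smul_left (-(2 : ℝ)⁻¹)).congr_left fun l => ?_
    simp only [Pi.smul_apply]
    rw [← exp_add_smul, neg_one_mul, hneg, Units.mul_inv, heven.neg_pow, add_neg_cancel, zero_smul,
      NormedSpace.exp_zero]
    module
  exact (hF.add h2).congr_left fun l => by simp

/-- The Trotter-Suzuki formula of order `2k` agrees with `exp(l (P + Q))` up to `O(l^(2k+1))`. -/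
theorem isBigO_suzukiFormula (P Q : 𝔸) (k : ℕ) :
    (fun l : ℝ => (suzukiFormula (expUnit P) (expUnit Q) (k + 1) l).val
      - NormedSpace.exp (l • (P + Q))) =O[𝓝 0] fun l : ℝ => l ^ (2 * k + 3) := by
  have hSa (k : ℕ) : AnalyticUnit (suzukiFormula (expUnit P) (expUnit Q) (k + 1)) :=
    analyticUnit_suzukiFormula (analyticUnit_expUnit P) (analyticUnit_expUnit Q) k
  induction k with
  | zero =>
    refine isBigO_succ_of_symmetric (hSa 0) (suzukiFormula_neg (expUnit_neg P) (expUnit_neg Q) 1)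
      (P + Q) one_le_two even_two ?_
    -- With base $1$ and correction $lM$, additivity of corrections gives first-order consistency;
    -- symmetry then supplies the remaining order.
    have hX (M : 𝔸) : ExpandsTo 1 1 (fun l : ℝ => NormedSpace.exp (l • M)) (fun _ => 1)
        (fun l => l • M) := by
      refine ⟨?_, ?_, isBigO_exp_smul_sub_one_sub M⟩
      · simpa using isBigO_zero _ _
      · simpa using isBigO_pow_smul 1 (continuousAt_const (y := M))
    have hP := (hX P).comp_mul 2⁻¹
    have hQ := (hX Q).comp_mul 2⁻¹
    have h := ((((hP.mul le_rfl hQ).mul le_rfl hQ).mul le_rfl hP).rem.sub (hX (P + Q)).rem)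
    refine h.congr_left fun l => ?_
    simp only [suzukiFormula, Units.val_mul, coe_expUnit, inv_mul_eq_div, mul_one]
    module
  | succ k ih =>
    refine isBigO_succ_of_symmetric (hSa (k + 1))
      (suzukiFormula_neg (expUnit_neg P) (expUnit_neg Q) (k + 2))
      (P + Q) (m := 2 * k + 4) (by omega) ⟨k + 2, by ring⟩ ?_
    obtain ⟨F, hF⟩ := exists_isBigO_sub_pow_smul
      ((hSa k).val.sub (analyticAt_exp_smul (P + Q) 0)) (2 * k + 3) ih
    set S := suzukiFormula (expUnit P) (expUnit Q) (k + 1) with hS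
    have hX : ExpandsTo (2 * k + 3) 1 (fun l => (S l).val)
        (fun l : ℝ => NormedSpace.exp (l • (P + Q))) (fun l => l ^ (2 * k + 3) • F) :=
      ⟨isBigO_exp_smul_sub_one _, isBigO_pow_smul _ continuousAt_const, hF⟩
    have hd : 1 ≤ 2 * k + 3 := by omega
    set s := suzuki (k + 2) with hs
    have hA := hX.comp_mul s
    have hB := hX.comp_mul (1 - 4 * s)
    have key := ((((hA.mul hd hA).mul hd hB).mul hd hA).mul hd hA).rem
    refine key.congr_left fun l => ?_
    have hy : (s * l) ^ (2 * k + 3) • F + (s * l) ^ (2 * k + 3) • F +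
        ((1 - 4 * s) * l) ^ (2 * k + 3) • F + (s * l) ^ (2 * k + 3) • F +
        (s * l) ^ (2 * k + 3) • F = 0 := by
      simp only [mul_pow, ← add_smul]
      have : s ^ (2 * k + 3) * l ^ (2 * k + 3) + s ^ (2 * k + 3) * l ^ (2 * k + 3) +
        (1 - 4 * s) ^ (2 * k + 3) * l ^ (2 * k + 3) + s ^ (2 * k + 3) * l ^ (2 * k + 3) +
        s ^ (2 * k + 3) * l ^ (2 * k + 3) = 0 := by
        linear_combination l ^ (2 * k + 3) * suzuki_pow k
      rw [this, zero_smul]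
    rw [hy, sub_zero]
    simp only [← exp_add_smul]
    congr 3
    ring

end Order
end HybridAdder

namespace HybridAdder

open Asymptotics Filter Topology
open scoped ENNReal

/-! ### Uniformity in the algebra and in the generators -/

section Uniform

theorem map_expUnit {𝔸 𝔹 : Type*} [NormedRing 𝔸] [NormedAlgebra ℝ 𝔸] [CompleteSpace 𝔸]
    [NormedRing 𝔹] [NormedAlgebra ℝ 𝔹] [CompleteSpace 𝔹] (φ : 𝔸 →ₐ[ℝ] 𝔹) (hφ : Continuous φ)
    (M : 𝔸) (t : ℝ) : Units.map (φ : 𝔸 →* 𝔹) (expUnit M t) = expUnit (φ M) t := by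
  let +nondep : NormedAlgebra ℚ 𝔸 := .restrictScalars ℚ ℝ 𝔸
  let +nondep : NormedAlgebra ℚ 𝔹 := .restrictScalars ℚ ℝ 𝔹
  ext
  have := NormedSpace.map_exp φ hφ (t • M)
  simpa using this

variable {I : Type*} (B : I → Type*) [∀ i, NormedRing (B i)] [∀ i, NormedAlgebra ℝ (B i)]
  [∀ i, NormOneClass (B i)]

/-- The coordinate homomorphisms of a bounded product of normed algebras. -/
def lpEvalAlgHom (i : I) : lp B ∞ →ₐ[ℝ] B i where
  toFun f := f i
  map_one' := rfl
  map_mul' _ _ := rfl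
  map_zero' := rfl
  map_add' _ _ := rfl
  commutes' _ := rfl

theorem norm_lpEvalAlgHom_le (i : I) (f : lp B ∞) : ‖lpEvalAlgHom B i f‖ ≤ ‖f‖ :=
  lp.norm_apply_le_norm (by simp) f i

theorem continuous_lpEvalAlgHom (i : I) : Continuous (lpEvalAlgHom B i) :=
  AddMonoidHomClass.continuous_of_bound (lpEvalAlgHom B i) 1 fun f => by
    simpa using norm_lpEvalAlgHom_le B i f

/-- An estimate which holds in all Banach algebras is uniform over families of Banach algebras. -/
theorem exists_uniform_bound.{u, v}
    (Φ : ∀ (𝔸 : Type (max u v)) [NormedRing 𝔸] [NormedAlgebra ℝ 𝔸] [CompleteSpace 𝔸], 𝔸 → 𝔸 → ℝ → 𝔸)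
    {ι : Type u} (B : ι → Type v) [∀ i, NormedRing (B i)] [∀ i, NormedAlgebra ℝ (B i)]
    [∀ i, NormOneClass (B i)] [∀ i, CompleteSpace (B i)] (Ψ : ∀ i, B i → B i → ℝ → B i) (m : ℕ)
    (hΦ : ∀ (𝔸 : Type (max u v)) [NormedRing 𝔸] [NormedAlgebra ℝ 𝔸] [CompleteSpace 𝔸] (M N : 𝔸),
      Φ 𝔸 M N =O[𝓝 0] fun t : ℝ => t ^ m)
    (hnat : ∀ (𝔸 : Type (max u v)) [NormedRing 𝔸] [NormedAlgebra ℝ 𝔸] [CompleteSpace 𝔸] (i : ι)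
      (φ : 𝔸 →ₐ[ℝ] B i) (_ : Continuous φ) (M N : 𝔸) (t : ℝ), φ (Φ 𝔸 M N t) = Ψ i (φ M) (φ N) t) :
    ∃ K δ : ℝ, 0 < K ∧ 0 < δ ∧ ∀ (i : ι) (M N : B i), ‖M‖ ≤ 1 → ‖N‖ ≤ 1 → ∀ t : ℝ, |t| < δ →
      ‖Ψ i M N t‖ ≤ K * |t| ^ m := by
  -- One coordinate for every pair of contractions in every algebra. `M` and `N` are the
  -- tautological sections: their coordinates at an index are the pair that the index names.
  let I := Σ i : ι, {x : B i × B i // ‖x.1‖ ≤ 1 ∧ ‖x.2‖ ≤ 1}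
  let E : I → Type v := fun i => B i.1
  let M : lp E ∞ := ⟨fun i => i.2.1.1, memℓp_infty ⟨1, by rintro _ ⟨i, rfl⟩; exact i.2.2.1⟩⟩
  let N : lp E ∞ := ⟨fun i => i.2.1.2, memℓp_infty ⟨1, by rintro _ ⟨i, rfl⟩; exact i.2.2.2⟩⟩
  obtain ⟨K, hK, h⟩ := (hΦ (lp E ∞) M N).exists_pos
  obtain ⟨δ, hδ, hb⟩ := Metric.eventually_nhds_iff.1 h.bound
  refine ⟨K, δ, hK, hδ, fun i M' N' hM hN t ht => ?_⟩
  let j : I := ⟨i, (M', N'), hM, hN⟩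
  have h1 := hnat (lp E ∞) i (lpEvalAlgHom E j) (continuous_lpEvalAlgHom E j) M N t
  have h2 := hb (y := t) (by simpa using ht)
  rw [norm_pow, Real.norm_eq_abs] at h2
  calc ‖Ψ i M' N' t‖ = ‖lpEvalAlgHom E j (Φ (lp E ∞) M N t)‖ := by rw [h1]; rfl
    _ ≤ _ := (norm_lpEvalAlgHom_le E j _).trans h2

end Uniform

section UniformMatrix

variable {𝔸 : Type*} [NormedRing 𝔸] [NormedAlgebra ℝ 𝔸] [CompleteSpace 𝔸]

theorem expUnit_smul (c : ℝ) (M : 𝔸) (t : ℝ) : expUnit (c • M) t = expUnit M (c * t) := by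
  ext; simp [smul_smul, mul_comm]

theorem exists_eq_smul_norm_le_one {E : Type*} [NormedAddCommGroup E] [NormedSpace ℝ E] {C : ℝ}
    (hC : 0 ≤ C) (M : E) (hM : ‖M‖ ≤ C) : ∃ M' : E, ‖M'‖ ≤ 1 ∧ M = C • M' := by
  rcases hC.eq_or_lt with rfl | hC
  · exact ⟨0, by simp, by simpa using hM⟩
  · refine ⟨C⁻¹ • M, ?_, by rw [smul_smul, mul_inv_cancel₀ hC.ne', one_smul]⟩
    rw [norm_smul, norm_inv, Real.norm_of_nonneg hC.le, inv_mul_le_one₀ hC]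
    exact hM

/-- The error of the commutator formula, uniformly in the dimension and in the generators. -/
theorem exists_commutatorFormula_bound (p : ℕ) :
    ∃ K δ : ℝ, 0 < K ∧ 0 < δ ∧ ∀ (n : ℕ) (M N : Op (n + 1)) (C : ℝ), 0 ≤ C → ‖M‖ ≤ C → ‖N‖ ≤ C →
      ∀ t : ℝ, C * |t| < δ →
      ‖(commutatorFormula (expUnit M) (expUnit N) (p + 1) t).val
        - NormedSpace.exp (t ^ 2 • (M * N - N * M))‖ ≤ K * (C * |t|) ^ (2 * p + 3) := by
  obtain ⟨K, δ, hK, hδ, h⟩ := exists_uniform_bound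
    (fun 𝔸 [NormedRing 𝔸] [NormedAlgebra ℝ 𝔸] [CompleteSpace 𝔸] (M N : 𝔸) (t : ℝ) =>
      (commutatorFormula (expUnit M) (expUnit N) (p + 1) t).val
        - NormedSpace.exp (t ^ 2 • (M * N - N * M)))
    (fun n : ℕ => Op (n + 1))
    (fun n M N t => (commutatorFormula (expUnit M) (expUnit N) (p + 1) t).val
        - NormedSpace.exp (t ^ 2 • (M * N - N * M))) (2 * p + 3)
    (fun 𝔸 _ _ _ M N => isBigO_commutatorFormula M N p)
    (fun 𝔸 _ _ _ n φ hφ M N t => by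
      have h1 := congrArg Units.val (map_commutatorFormula (Units.map (φ : 𝔸 →* Op (n + 1)))
        (expUnit M) (expUnit N) (p + 1) t)
      have h2 := congrArg Units.val (map_expUnit φ hφ (M * N - N * M) (t ^ 2))
      simp only [map_expUnit φ hφ] at h1
      simp only [Units.coe_map, MonoidHom.coe_coe, coe_expUnit, map_sub, map_mul] at h1 h2
      rw [map_sub, h1, h2])
  refine ⟨K, δ, hK, hδ, fun n M N C hC hM hN t ht => ?_⟩
  -- Scaling both generators by $C$ amounts to running contractions for the time $Ct$; the
  -- commutator picks up $C^2$, matching $t^2$.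
  obtain ⟨M', hM', rfl⟩ := exists_eq_smul_norm_le_one hC M hM
  obtain ⟨N', hN', rfl⟩ := exists_eq_smul_norm_le_one hC N hN
  have h1 := h n M' N' hM' hN' (C * t) (by rwa [abs_mul, abs_of_nonneg hC])
  rw [abs_mul, abs_of_nonneg hC] at h1
  convert h1 using 3
  · rw [← commutatorFormula_comp_mul]
    congr 2 <;> ext1 s <;> exact expUnit_smul _ _ _
  · congr 1
    simp only [smul_mul_assoc, mul_smul_comm, smul_sub, smul_smul]
    congr 2 <;> ring

/-- The error of the Trotter-Suzuki formula, uniformly in the dimension and in the generators. -/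
theorem exists_suzukiFormula_bound (k : ℕ) :
    ∃ K δ : ℝ, 0 < K ∧ 0 < δ ∧ ∀ (n : ℕ) (P Q : Op (n + 1)) (C : ℝ), 0 ≤ C → ‖P‖ ≤ C → ‖Q‖ ≤ C →
      ∀ l : ℝ, C * |l| < δ →
      ‖(suzukiFormula (expUnit P) (expUnit Q) (k + 1) l).val
        - NormedSpace.exp (l • (P + Q))‖ ≤ K * (C * |l|) ^ (2 * k + 3) := by
  obtain ⟨K, δ, hK, hδ, h⟩ := exists_uniform_bound
    (fun 𝔸 [NormedRing 𝔸] [NormedAlgebra ℝ 𝔸] [CompleteSpace 𝔸] (P Q : 𝔸) (l : ℝ) =>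
      (suzukiFormula (expUnit P) (expUnit Q) (k + 1) l).val - NormedSpace.exp (l • (P + Q)))
    (fun n : ℕ => Op (n + 1))
    (fun n P Q l => (suzukiFormula (expUnit P) (expUnit Q) (k + 1) l).val
      - NormedSpace.exp (l • (P + Q))) (2 * k + 3)
    (fun 𝔸 _ _ _ P Q => isBigO_suzukiFormula P Q k)
    (fun 𝔸 _ _ _ n φ hφ P Q l => by
      have h1 := congrArg Units.val (map_suzukiFormula (Units.map (φ : 𝔸 →* Op (n + 1)))
        (expUnit P) (expUnit Q) (k + 1) l)
      have h2 := congrArg Units.val (map_expUnit φ hφ (P + Q) l)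
      simp only [map_expUnit φ hφ] at h1
      simp only [Units.coe_map, MonoidHom.coe_coe, coe_expUnit, map_add] at h1 h2
      rw [map_sub, h1, h2])
  refine ⟨K, δ, hK, hδ, fun n P Q C hC hP hQ l hl => ?_⟩
  obtain ⟨P', hP', rfl⟩ := exists_eq_smul_norm_le_one hC P hP
  obtain ⟨Q', hQ', rfl⟩ := exists_eq_smul_norm_le_one hC Q hQ
  have h1 := h n P' Q' hP' hQ' (C * l) (by rwa [abs_mul, abs_of_nonneg hC])
  rw [abs_mul, abs_of_nonneg hC] at h1
  convert h1 using 3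
  · rw [← suzukiFormula_comp_mul]
    congr 2 <;> ext1 s <;> exact expUnit_smul _ _ _
  · congr 1
    rw [← smul_add, smul_smul, mul_comm]

end UniformMatrix

end HybridAdder

namespace HybridAdder

/-! ### Evaluation of circuits, gate counts and run times -/

section Circuits

section Eval

variable {G : Type*} [Group G] {e : Gate → G}

theorem prod_map_invCircuit (he : ∀ g, e g.inv = (e g)⁻¹) (C : Circuit) :
    ((invCircuit C).map e).prod = ((C.map e).prod)⁻¹ := by
  simp only [invCircuit, List.map_reverse, List.map_map, List.prod_inv_reverse]
  congr 3
  ext g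
  exact he g

theorem prod_map_bch (he : ∀ g, e g.inv = (e g)⁻¹) (U V : ℝ → Circuit) (p : ℕ) (t : ℝ) :
    ((bch U V p t).map e).prod =
      commutatorFormula (fun s => ((U s).map e).prod) (fun s => ((V s).map e).prod) p t := by
  induction p, t using commutatorFormula.induct with
  | case1 t => simp [commutatorFormula, bch]
  | case2 t => simp [commutatorFormula, bch, mul_assoc]
  | case3 t p ih1 ih2 ih3 ih4 =>
    simp only [commutatorFormula, bch, List.map_append, List.prod_append, prod_map_invCircuit he,
      ih1, ih2, ih3, ih4]

theorem prod_map_trotter (e : Gate → G) (L R : ℝ → Circuit) (k : ℕ) (l : ℝ) :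
    ((trotter L R k l).map e).prod =
      suzukiFormula (fun s => ((L s).map e).prod) (fun s => ((R s).map e).prod) k l := by
  induction k, l using suzukiFormula.induct with
  | case1 l => simp [suzukiFormula, trotter]
  | case2 l => simp [suzukiFormula, trotter, mul_assoc]
  | case3 l k ih1 ih2 =>
    simp only [suzukiFormula, trotter, List.map_append, List.prod_append, ih1, ih2]

theorem prod_map_signedFamily (he : ∀ g, e g.inv = (e g)⁻¹) (C : ℝ → Circuit) (l : ℝ) :
    ((signedFamily C l).map e).prod =
      if 0 ≤ l then ((C l).map e).prod else (((C (-l)).map e).prod)⁻¹ := by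
  unfold signedFamily
  split_ifs
  · rfl
  · exact prod_map_invCircuit he _

end Eval

section Count

variable {f : Gate → Bool}

theorem countP_invCircuit (hf : ∀ g, f g.inv = f g) (C : Circuit) :
    (invCircuit C).countP f = C.countP f := by
  simp only [invCircuit, List.countP_reverse, List.countP_map]
  congr 1
  ext g
  exact hf g

/-- Stated for any inversion-invariant predicate, so that it yields both the number of exponentials
and the length of the circuit. -/
theorem countP_bch (hf : ∀ g, f g.inv = f g) {U V : ℝ → Circuit} {a b : ℕ}
    (hU : ∀ t, (U t).countP f = a) (hV : ∀ t, (V t).countP f = b) (p : ℕ) (t : ℝ) :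
    (bch U V (p + 1) t).countP f = 2 * (a + b) * 6 ^ p := by
  induction p generalizing t with
  | zero => simp only [bch, List.countP_append, hU, hV]; ring
  | succ p ih =>
    simp only [bch, List.countP_append, countP_invCircuit hf, ih]
    ring

theorem countP_trotter {L R : ℝ → Circuit} {a b : ℕ}
    (hL : ∀ t, (L t).countP f = a) (hR : ∀ t, (R t).countP f = b) (k : ℕ) (l : ℝ) :
    (trotter L R (k + 1) l).countP f = 2 * (a + b) * 5 ^ k := by
  induction k generalizing l with
  | zero => simp only [trotter, List.countP_append, hL, hR]; ring
  | succ k ih =>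
    simp only [trotter, List.countP_append, ih]
    ring

theorem countP_signedFamily (hf : ∀ g, f g.inv = f g) {C : ℝ → Circuit} {a : ℕ}
    (hC : ∀ l, (C l).countP f = a) (l : ℝ) : (signedFamily C l).countP f = a := by
  unfold signedFamily
  split_ifs
  · exact hC l
  · rw [countP_invCircuit hf, hC]

theorem exists_order_eq (pA pB : ℝ) : ∃ p, order pA pB = p + 1 :=
  Nat.exists_eq_add_of_le' (le_max_right _ _)

theorem numExponentials_addCircuit (pA pB t : ℝ) :
    (numExponentials (addCircuit pA pB t) : ℝ) ≤ 1.07 * 30 ^ order pA pB := by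
  obtain ⟨p, hp⟩ := exists_order_eq pA pB
  have hf (g : Gate) : g.inv.isExponential = g.isExponential := by cases g <;> rfl
  have hL : ∀ l, (leftCircuit (p + 1) l).countP Gate.isExponential = 4 * 6 ^ p :=
    countP_signedFamily hf fun l => by
      rw [List.countP_append, List.countP_append, countP_bch hf (a := 1) (b := 1)]
      · simp [Gate.isExponential]
      · intro t; rfl
      · intro t; rfl
  have hR : ∀ l, (rightCircuit (p + 1) l).countP Gate.isExponential = 4 * 6 ^ p :=
    countP_signedFamily hf fun l => by
      rw [List.countP_append, List.countP_append, countP_bch hf (a := 1) (b := 1)]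
      · simp [Gate.isExponential]
      · intro t; rfl
      · intro t; rfl
  -- The exact count is $16\cdot30^{q-1}=\tfrac{8}{15}\cdot30^q$, well below the claimed bound.
  have h : numExponentials (addCircuit pA pB t) = 16 * 30 ^ p := by
    simp only [numExponentials, addCircuit, hp, List.countP_append, countP_trotter hL hR]
    rw [show (30 : ℕ) = 6 * 5 by norm_num, mul_pow]
    simp [Gate.isExponential]
    ring
  rw [h, hp, pow_succ]
  push_cast
  have : (0 : ℝ) ≤ 30 ^ p := by positivity
  linarith

theorem exists_length_addCircuit (pA pB : ℝ) : ∃ a, ∀ t, (addCircuit pA pB t).length = a := by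
  obtain ⟨p, hp⟩ := exists_order_eq pA pB
  have hf (g : Gate) : (fun _ : Gate => true) g.inv = (fun _ : Gate => true) g := rfl
  have hL : ∀ l, (leftCircuit (p + 1) l).countP (fun _ => true) = 2 + 2 * (3 + 1) * 6 ^ p + 2 :=
    countP_signedFamily hf fun l => by
      rw [List.countP_append, List.countP_append, countP_bch hf (a := 3) (b := 1)]
      · rfl
      · intro t; simp
      · intro t; simp
  have hR : ∀ l, (rightCircuit (p + 1) l).countP (fun _ => true) = 1 + 2 * (3 + 3) * 6 ^ p + 1 :=
    countP_signedFamily hf fun l => by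
      rw [List.countP_append, List.countP_append, countP_bch hf (a := 3) (b := 3)]
      · rfl
      · intro t; simp
      · intro t; simp
  refine ⟨1 + 2 * ((2 + 2 * (3 + 1) * 6 ^ p + 2) + (1 + 2 * (3 + 3) * 6 ^ p + 1)) * 5 ^ p + 1,
    fun t => ?_⟩
  rw [← List.countP_true]
  simp only [addCircuit, hp, List.countP_append, countP_trotter hL hR]
  rfl

end Count

section Times

/-- The exponentials are run for a nonzero time of modulus at most `a`. -/
def Gate.TimeLE (a : ℝ) : Gate → Prop
  | .encA τ => τ ≠ 0 ∧ |τ| ≤ a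
  | .encB τ => τ ≠ 0 ∧ |τ| ≤ a
  | _ => True

theorem Gate.TimeLE.mono {a b : ℝ} (hab : a ≤ b) {g : Gate} (h : g.TimeLE a) : g.TimeLE b := by
  cases g <;> first | trivial | exact ⟨h.1, h.2.trans hab⟩

theorem Gate.TimeLE.inv {a : ℝ} {g : Gate} (h : g.TimeLE a) : g.inv.TimeLE a := by
  cases g <;> first | trivial | exact ⟨neg_ne_zero.2 h.1, by rw [abs_neg]; exact h.2⟩

theorem timeLE_invCircuit {a : ℝ} {C : Circuit} (h : ∀ g ∈ C, g.TimeLE a) :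
    ∀ g ∈ invCircuit C, g.TimeLE a := by
  intro g hg
  simp only [invCircuit, List.mem_reverse, List.mem_map] at hg
  obtain ⟨g', hg', rfl⟩ := hg
  exact (h g' hg').inv

/-- Nonvanishing of the times is tracked because the approximations are controlled only at positive
times, and `runFor` at time $0$ returns the arbitrary value `U 0`. It persists since
$\beta_p,\gamma_p\ne0$. -/
theorem exists_timeLE_bch (p : ℕ) : ∃ c : ℝ, 0 < c ∧ ∀ U V : ℝ → Circuit,
    (∀ t ≠ 0, ∀ g ∈ U t, g.TimeLE |t|) → (∀ t ≠ 0, ∀ g ∈ V t, g.TimeLE |t|) →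
    ∀ t ≠ 0, ∀ g ∈ bch U V (p + 1) t, g.TimeLE (c * |t|) := by
  induction p with
  | zero =>
    refine ⟨1, one_pos, fun U V hU hV t ht g hg => ?_⟩
    have hU' := hU (-t) (neg_ne_zero.2 ht) g
    have hV' := hV (-t) (neg_ne_zero.2 ht) g
    rw [abs_neg] at hU' hV'
    rw [one_mul]
    simp only [bch, List.mem_append] at hg
    rcases hg with ((hg | hg) | hg) | hg
    exacts [hU t ht g hg, hV t ht g hg, hU' hg, hV' hg]
  | succ p ih =>
    obtain ⟨c, hc, ih⟩ := ih
    have hγ := bchGamma_pos (p + 1) (by omega)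
    have hβ := bchBeta_pos (p + 1) (by omega)
    refine ⟨c * (bchGamma (p + 1) + bchBeta (p + 1)), by positivity, fun U V hU hV t ht => ?_⟩
    have key (a : ℝ) (ha : a ≠ 0) (ha' : |a| ≤ bchGamma (p + 1) + bchBeta (p + 1)) :
        ∀ g ∈ bch U V (p + 1) (a * t),
          g.TimeLE (c * (bchGamma (p + 1) + bchBeta (p + 1)) * |t|) := by
      intro g hg
      refine (ih U V hU hV (a * t) (mul_ne_zero ha ht) g hg).mono ?_
      rw [abs_mul, mul_assoc]
      gcongr
    have k1 := key (bchGamma (p + 1)) hγ.ne' (by rw [abs_of_pos hγ]; linarith)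
    have k2 := key (-bchGamma (p + 1)) (by linarith) (by rw [abs_neg, abs_of_pos hγ]; linarith)
    have k3 := timeLE_invCircuit
      (key (bchBeta (p + 1)) hβ.ne' (by rw [abs_of_pos hβ]; linarith))
    have k4 := timeLE_invCircuit
      (key (-bchBeta (p + 1)) (by linarith) (by rw [abs_neg, abs_of_pos hβ]; linarith))
    rw [neg_mul] at k2 k4
    intro g hg
    simp only [bch, List.mem_append] at hg
    rcases hg with ((((hg | hg) | hg) | hg) | hg) | hg
    exacts [k1 g hg, k2 g hg, k3 g hg, k4 g hg, k1 g hg, k2 g hg]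

theorem exists_timeLE_trotter (k : ℕ) : ∃ c : ℝ, 0 < c ∧ ∀ (L R : ℝ → Circuit) (a : ℝ), 0 ≤ a →
    (∀ l ≠ 0, ∀ g ∈ L l, g.TimeLE (a * √|l|)) → (∀ l ≠ 0, ∀ g ∈ R l, g.TimeLE (a * √|l|)) →
    ∀ l ≠ 0, ∀ g ∈ trotter L R (k + 1) l, g.TimeLE (c * a * √|l|) := by
  induction k with
  | zero =>
    refine ⟨1, one_pos, fun L R a ha hL hR l hl g hg => ?_⟩
    have h2 : a * √|l / 2| ≤ 1 * a * √|l| := by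
      rw [one_mul, abs_div, abs_two]
      gcongr
      linarith [abs_nonneg l]
    have hl' : l / 2 ≠ 0 := by positivity
    simp only [trotter, List.mem_append] at hg
    rcases hg with ((hg | hg) | hg) | hg
    exacts [(hL _ hl' g hg).mono h2, (hR _ hl' g hg).mono h2, (hR _ hl' g hg).mono h2,
      (hL _ hl' g hg).mono h2]
  | succ k ih =>
    obtain ⟨c, hc, ih⟩ := ih
    have hs := suzuki_pos (k + 2) (by omega)
    have hs' := one_sub_four_mul_suzuki_neg (k + 2) (by omega)
    set s := suzuki (k + 2) with hs_def
    refine ⟨c * (√|s| + √|1 - 4 * s|), by positivity, fun L R a ha hL hR l hl => ?_⟩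
    have key (b : ℝ) (hb : b ≠ 0) (hb' : √|b| ≤ √|s| + √|1 - 4 * s|) :
        ∀ g ∈ trotter L R (k + 1) (b * l),
          g.TimeLE (c * (√|s| + √|1 - 4 * s|) * a * √|l|) := by
      intro g hg
      refine (ih L R a ha hL hR (b * l) (mul_ne_zero hb hl) g hg).mono ?_
      rw [abs_mul, Real.sqrt_mul (abs_nonneg b)]
      calc c * a * (√|b| * √|l|) = c * √|b| * a * √|l| := by ring
        _ ≤ _ := by gcongr
    have k1 := key s hs.ne' (by linarith [Real.sqrt_nonneg |1 - 4 * s|])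
    have k2 := key (1 - 4 * s) hs'.ne (by linarith [Real.sqrt_nonneg |s|])
    intro g hg
    simp only [trotter, List.mem_append] at hg
    rcases hg with (((hg | hg) | hg) | hg) | hg
    exacts [k1 g hg, k1 g hg, k2 g hg, k1 g hg, k1 g hg]

theorem timeLE_signedFamily {C : ℝ → Circuit} {a : ℝ}
    (h : ∀ l > 0, ∀ g ∈ C l, g.TimeLE (a * √l)) :
    ∀ l ≠ 0, ∀ g ∈ signedFamily C l, g.TimeLE (a * √|l|) := by
  intro l hl
  unfold signedFamily
  split_ifs with h0
  · rw [abs_of_nonneg h0]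
    exact h l (lt_of_le_of_ne h0 hl.symm)
  · rw [abs_of_neg (not_le.1 h0)]
    exact timeLE_invCircuit (h (-l) (by linarith))

/-- The exponentials in `ADD(t)` are run for times of order `√t`. -/
theorem exists_timeLE_addCircuit (pA pB : ℝ) :
    ∃ c : ℝ, 0 < c ∧ ∀ t > 0, ∀ g ∈ addCircuit pA pB t, g.TimeLE (c * √t) := by
  obtain ⟨p, hp⟩ := exists_order_eq pA pB
  obtain ⟨c₁, hc₁, h₁⟩ := exists_timeLE_bch p
  obtain ⟨c₂, hc₂, h₂⟩ := exists_timeLE_trotter p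
  have hb (U V : ℝ → Circuit) (hU : ∀ t ≠ 0, ∀ g ∈ U t, g.TimeLE |t|)
      (hV : ∀ t ≠ 0, ∀ g ∈ V t, g.TimeLE |t|) (l : ℝ) (hl : 0 < l) :
      ∀ g ∈ bch U V (p + 1) √(l / 2), g.TimeLE (c₁ * √l) := by
    intro g hg
    refine (h₁ U V hU hV _ (Real.sqrt_pos.2 (half_pos hl)).ne' g hg).mono ?_
    rw [abs_of_nonneg (Real.sqrt_nonneg _)]
    gcongr
    linarith
  have hL : ∀ l ≠ 0, ∀ g ∈ leftCircuit (p + 1) l, g.TimeLE (c₁ * √|l|) :=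
    timeLE_signedFamily fun l hl g hg => by
      simp only [List.mem_append, List.mem_cons, List.not_mem_nil, or_false] at hg
      rcases hg with ((rfl | rfl) | hg) | rfl | rfl
      · trivial
      · trivial
      · refine hb _ _ ?_ ?_ l hl g hg <;> intro t ht <;> simp [Gate.TimeLE, ht]
      · trivial
      · trivial
  have hR : ∀ l ≠ 0, ∀ g ∈ rightCircuit (p + 1) l, g.TimeLE (c₁ * √|l|) :=
    timeLE_signedFamily fun l hl g hg => by
      simp only [List.mem_append, List.mem_cons, List.not_mem_nil, or_false] at hg
      rcases hg with (rfl | hg) | rfl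
      · trivial
      · refine hb _ _ ?_ ?_ l hl g hg <;> intro t ht <;> simp [Gate.TimeLE, ht]
      · trivial
  refine ⟨c₂ * c₁, by positivity, fun t ht g hg => ?_⟩
  simp only [addCircuit, hp, List.mem_append, List.mem_cons, List.not_mem_nil, or_false] at hg
  rcases hg with (rfl | hg) | rfl
  · trivial
  · simpa [abs_of_pos ht] using h₂ _ _ c₁ hc₁.le hL hR t ht.ne' g hg
  · trivial

end Times

end Circuits

end HybridAdder

namespace HybridAdder

/-! ### Unitary gates and skew-adjoint generators -/

section Gates

variable {n : ℕ}

/-- The skew-adjoint generator `i [[0, A], [A†, 0]]` of the block encoding of `A`. -/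
noncomputable def blockGen (A : Matrix (Fin n) (Fin n) ℂ) : skewAdjoint (Op n) :=
  ⟨Matrix.fromBlocks 0 (Complex.I • A) (Complex.I • Aᴴ) 0, by
    rw [skewAdjoint.mem_iff, Matrix.star_eq_conjTranspose, Matrix.fromBlocks_conjTranspose,
      Matrix.fromBlocks_neg]
    simp [Matrix.conjTranspose_smul]⟩

theorem coe_blockGen (A : Matrix (Fin n) (Fin n) ℂ) :
    (blockGen A : Op n) = Matrix.fromBlocks 0 (Complex.I • A) (Complex.I • Aᴴ) 0 := rfl

theorem I_mul_smul_fromBlocks (A : Matrix (Fin n) (Fin n) ℂ) (t : ℝ) :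
    (Complex.I * (t : ℂ)) • (Matrix.fromBlocks 0 A Aᴴ 0 : Op n) = t • (blockGen A : Op n) := by
  rw [coe_blockGen, ← Complex.coe_smul, mul_comm, mul_smul, Matrix.fromBlocks_smul]
  simp

/-- The one-parameter group of unitaries generated by a skew-adjoint operator. -/
noncomputable def skewExp (M : skewAdjoint (Op n)) (t : ℝ) : unitary (Op n) :=
  ⟨NormedSpace.exp (t • (M : Op n)), by
    let +nondep : NormedAlgebra ℚ (Op n) := .restrictScalars ℚ ℝ (Op n)
    exact NormedSpace.exp_mem_unitary_of_mem_skewAdjoint (skewAdjoint.smul_mem t M.2)⟩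

theorem coe_skewExp (M : skewAdjoint (Op n)) (t : ℝ) :
    (skewExp M t : Op n) = NormedSpace.exp (t • (M : Op n)) := rfl

theorem toUnits_skewExp (M : skewAdjoint (Op n)) (t : ℝ) :
    Unitary.toUnits (skewExp M t) = expUnit (M : Op n) t := Units.ext rfl

theorem skewExp_neg (M : skewAdjoint (Op n)) (t : ℝ) : skewExp M (-t) = (skewExp M t)⁻¹ := by
  apply Unitary.toUnits_injective
  rw [map_inv, toUnits_skewExp, toUnits_skewExp, expUnit_neg]

theorem blockEnc_eq_skewExp (A : Matrix (Fin n) (Fin n) ℂ) (t : ℝ) :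
    blockEnc A t = skewExp (blockGen A) t := by
  rw [blockEnc, I_mul_smul_fromBlocks, coe_skewExp]

/-- Conjugation of a skew-adjoint operator by a unitary. -/
def conjSkew (u : unitary (Op n)) (M : skewAdjoint (Op n)) : skewAdjoint (Op n) :=
  ⟨u * M * star (u : Op n), skewAdjoint.conjugate M.2 u⟩

theorem conj_skewExp (u : unitary (Op n)) (M : skewAdjoint (Op n)) (t : ℝ) :
    u * skewExp M t * u⁻¹ = skewExp (conjSkew u M) t := by
  let +nondep : NormedAlgebra ℚ (Op n) := .restrictScalars ℚ ℝ (Op n)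
  apply Subtype.ext
  have := NormedSpace.exp_units_conj (Unitary.toUnits u) (t • (M : Op n))
  simp only [coe_skewExp, conjSkew, Submonoid.coe_mul]
  rw [← smul_mul_assoc, ← mul_smul_comm]
  exact this.symm

/-- Half of the commutator of skew-adjoint operators. -/
noncomputable def halfCommutator (M N : skewAdjoint (Op n)) : skewAdjoint (Op n) :=
  ⟨(2⁻¹ : ℝ) • ((M : Op n) * N - N * M), skewAdjoint.smul_mem _ (by
    rw [skewAdjoint.mem_iff, star_sub, star_mul, star_mul, skewAdjoint.mem_iff.1 M.2,
      skewAdjoint.mem_iff.1 N.2]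
    noncomm_ring)⟩

theorem qX_mem_unitary (n : ℕ) : qX n ∈ unitary (Op n) := by
  rw [Matrix.mem_unitaryGroup_iff, Matrix.star_eq_conjTranspose, qX,
    Matrix.fromBlocks_conjTranspose, Matrix.fromBlocks_multiply]
  simp

theorem qS_mem_unitary (n : ℕ) : qS n ∈ unitary (Op n) := by
  rw [Matrix.mem_unitaryGroup_iff, Matrix.star_eq_conjTranspose, qS,
    Matrix.fromBlocks_conjTranspose, Matrix.fromBlocks_multiply]
  simp [smul_smul]

theorem star_qX (n : ℕ) : star (qX n) = qX n := by
  rw [Matrix.star_eq_conjTranspose, qX, Matrix.fromBlocks_conjTranspose]; simp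

theorem star_qH (n : ℕ) : star (qH n) = qH n := by
  rw [Matrix.star_eq_conjTranspose, qH, Matrix.conjTranspose_smul, Matrix.fromBlocks_conjTranspose]
  simp

theorem star_qS (n : ℕ) :
    star (qS n) = Matrix.fromBlocks 1 0 0 (-(Complex.I • 1)) := by
  rw [Matrix.star_eq_conjTranspose, qS, Matrix.fromBlocks_conjTranspose]
  simp [Matrix.conjTranspose_smul]

theorem inv_sqrt_two_mul_self :
    ((1 / Real.sqrt 2 : ℝ) : ℂ) * ((1 / Real.sqrt 2 : ℝ) : ℂ) = 1 / 2 := by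
  rw [← Complex.ofReal_mul, div_mul_div_comm, Real.mul_self_sqrt (by norm_num)]
  norm_num

theorem qH_mul_mul_qH (M : Op n) :
    qH n * M * qH n = (1 / 2 : ℂ) • ((Matrix.fromBlocks 1 1 1 (-1) : Op n) * M *
      (Matrix.fromBlocks 1 1 1 (-1) : Op n)) := by
  rw [qH, smul_mul_assoc, smul_mul_assoc, mul_smul_comm, smul_smul, inv_sqrt_two_mul_self]

theorem qH_mem_unitary (n : ℕ) : qH n ∈ unitary (Op n) := by
  rw [Matrix.mem_unitaryGroup_iff, star_qH, ← mul_one (qH n), mul_assoc (qH n), one_mul, mul_one]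
  have := qH_mul_mul_qH (1 : Op n)
  rw [mul_one, mul_one] at this
  rw [this, Matrix.fromBlocks_multiply, Matrix.fromBlocks_smul]
  simp only [mul_one, mul_neg, neg_neg, add_neg_cancel, smul_zero]
  rw [← Matrix.fromBlocks_one, ← two_smul ℂ (1 : Matrix (Fin n) (Fin n) ℂ), smul_smul]
  norm_num

/-- The gates with exact block encodings, as unitaries. -/
noncomputable def exactGate (A B : Matrix (Fin n) (Fin n) ℂ) : Gate → unitary (Op n)
  | .x => ⟨qX n, qX_mem_unitary n⟩
  | .h => ⟨qH n, qH_mem_unitary n⟩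
  | .s => ⟨qS n, qS_mem_unitary n⟩
  | .sdg => ⟨qS n, qS_mem_unitary n⟩⁻¹
  | .encA τ => skewExp (blockGen A) τ
  | .encB τ => skewExp (blockGen B) τ

variable (A B : Matrix (Fin n) (Fin n) ℂ)

theorem exactGate_inv (g : Gate) : exactGate A B g.inv = (exactGate A B g)⁻¹ := by
  cases g with
  | x => exact Subtype.ext (star_qX n).symm
  | h => exact Subtype.ext (star_qH n).symm
  | s => rfl
  | sdg => exact (inv_inv _).symm
  | encA τ => exact skewExp_neg _ _
  | encB τ => exact skewExp_neg _ _

end Gates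

/-! ### Stability under perturbation of the factors -/

section Perturbation

/-- Telescoping, with perturbed factors of norm at most $2$ since they need not be unitary. The
crude factor $2^{\text{length}}$ is harmless: the length depends only on $q$. -/
theorem norm_prod_map_sub_le {ι R : Type*} [NormedRing R] [NormOneClass R] {f g : ι → R} {ε : ℝ}
    (hε₀ : 0 ≤ ε) (hε : ε ≤ 1) (l : List ι) (hf : ∀ x ∈ l, ‖f x‖ ≤ 1)
    (hg : ∀ x ∈ l, ‖g x - f x‖ ≤ ε) :
    ‖(l.map g).prod - (l.map f).prod‖ ≤ 2 ^ l.length * ε ∧ ‖(l.map g).prod‖ ≤ 2 ^ l.length := by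
  induction l with
  | nil => simpa using hε₀
  | cons x l ih =>
    obtain ⟨ih₁, ih₂⟩ := ih (fun y hy => hf y (List.mem_cons_of_mem x hy))
      fun y hy => hg y (List.mem_cons_of_mem x hy)
    have hfx := hf x List.mem_cons_self
    have hgx := hg x List.mem_cons_self
    have hgx' : ‖g x‖ ≤ 2 := by
      have := norm_add_le (g x - f x) (f x)
      rw [sub_add_cancel] at this
      linarith
    simp only [List.map_cons, List.prod_cons, List.length_cons, pow_succ]
    constructor
    · have : g x * (l.map g).prod - f x * (l.map f).prod =
          (g x - f x) * (l.map g).prod + f x * ((l.map g).prod - (l.map f).prod) := by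
        noncomm_ring
      rw [this]
      calc _ ≤ ‖g x - f x‖ * ‖(l.map g).prod‖ + ‖f x‖ * ‖(l.map g).prod - (l.map f).prod‖ :=
            (norm_add_le _ _).trans (add_le_add (norm_mul_le _ _) (norm_mul_le _ _))
        _ ≤ ε * 2 ^ l.length + 1 * (2 ^ l.length * ε) := by gcongr
        _ = _ := by ring
    · calc _ ≤ ‖g x‖ * ‖(l.map g).prod‖ := norm_mul_le _ _
        _ ≤ 2 * 2 ^ l.length := by gcongr
        _ = _ := mul_comm _ _

/-- A Neumann series makes `U` invertible. Then $\|U^{-1}\|\le1+\varepsilon\|U^{-1}\|$, so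
$\|U^{-1}\|\le2$ for $\varepsilon\le1/2$. -/
theorem norm_inv_sub_inv_le {n : ℕ} {U : Op (n + 1)} (V : unitary (Op (n + 1))) {ε : ℝ}
    (hε : ε ≤ 1 / 2) (h : ‖U - V‖ ≤ ε) :
    ‖U⁻¹ - ((V⁻¹ : unitary (Op (n + 1))) : Op (n + 1))‖ ≤ 2 * ε := by
  have hVi : ‖((V⁻¹ : unitary (Op (n + 1))) : Op (n + 1))‖ = 1 := CStarRing.norm_coe_unitary _
  have hVV : (V : Op (n + 1)) * ((V⁻¹ : unitary (Op (n + 1))) : Op (n + 1)) = 1 :=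
    congrArg Subtype.val (mul_inv_cancel V)
  have hU : IsUnit U := by
    have h1 : ‖((V⁻¹ : unitary (Op (n + 1))) : Op (n + 1)) * ((V : Op (n + 1)) - U)‖ < 1 := by
      rw [CStarRing.norm_coe_unitary_mul, norm_sub_rev]
      linarith
    have h2 := (Unitary.toUnits V).isUnit.mul (isUnit_one_sub_of_norm_lt_one h1)
    convert h2 using 1
    change U = (V : Op (n + 1)) * _
    rw [mul_sub, ← mul_assoc, hVV]
    noncomm_ring
  have hWU : U⁻¹ * U = 1 := Matrix.nonsing_inv_mul U ((Matrix.isUnit_iff_isUnit_det U).1 hU)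
  set W := U⁻¹
  set Vi := ((V⁻¹ : unitary (Op (n + 1))) : Op (n + 1))
  have e : W - Vi = W * ((V : Op (n + 1)) - U) * Vi := by
    rw [mul_sub, sub_mul, hWU, mul_assoc, hVV, mul_one, one_mul]
  have h1 : ‖W - Vi‖ ≤ ‖W‖ * ε := by
    rw [e, CStarRing.norm_mul_coe_unitary]
    refine (norm_mul_le _ _).trans ?_
    rw [norm_sub_rev]
    gcongr
  have h2 : ‖W‖ ≤ 2 := by
    have h3 := norm_add_le (W - Vi) Vi
    rw [sub_add_cancel, hVi] at h3
    nlinarith [norm_nonneg W]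
  exact h1.trans (mul_le_mul_of_nonneg_right h2 ((norm_nonneg _).trans h))

variable {n : ℕ}

theorem norm_mul_sub_mul_le (u₁ u₂ v₁ v₂ : unitary (Op n)) :
    ‖((u₁ * u₂ : unitary (Op n)) : Op n) - (v₁ * v₂ : unitary (Op n))‖
      ≤ ‖(u₁ : Op n) - v₁‖ + ‖(u₂ : Op n) - v₂‖ := by
  have : ((u₁ * u₂ : unitary (Op n)) : Op n) - (v₁ * v₂ : unitary (Op n)) =
      ((u₁ : Op n) - v₁) * (u₂ : Op n) + (v₁ : Op n) * ((u₂ : Op n) - v₂) := by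
    simp only [Submonoid.coe_mul]
    noncomm_ring
  rw [this]
  refine (norm_add_le _ _).trans_eq ?_
  rw [CStarRing.norm_mul_coe_unitary, CStarRing.norm_coe_unitary_mul]

theorem norm_inv_sub_inv (u v : unitary (Op n)) :
    ‖((u⁻¹ : unitary (Op n)) : Op n) - (v⁻¹ : unitary (Op n))‖ = ‖(u : Op n) - v‖ := by
  rw [← norm_star]
  change ‖star (star (u : Op n) - star (v : Op n))‖ = _
  rw [← star_sub, star_star]

theorem norm_conj_sub_conj (w u v : unitary (Op n)) :
    ‖((w * u * w⁻¹ : unitary (Op n)) : Op n) - (w * v * w⁻¹ : unitary (Op n))‖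
      = ‖(u : Op n) - v‖ := by
  simp only [Submonoid.coe_mul]
  rw [← sub_mul, ← mul_sub, CStarRing.norm_mul_coe_unitary, CStarRing.norm_coe_unitary_mul]

/-- For unitary factors errors just add. The window $|l|\le cT$ is two-sided and rescaled because
the recursion runs the factors at multiples of $l$, some of them negative. -/
theorem exists_suzukiFormula_perturbation (k : ℕ) : ∃ c N : ℝ, 0 < c ∧ 0 < N ∧
    ∀ (n : ℕ) (L R L' R' : ℝ → unitary (Op n)) (T ε : ℝ),
    (∀ l, |l| ≤ c * T → ‖(L l : Op n) - L' l‖ ≤ ε) →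
    (∀ l, |l| ≤ c * T → ‖(R l : Op n) - R' l‖ ≤ ε) → ∀ l, |l| ≤ T →
    ‖(suzukiFormula L R (k + 1) l).1 - (suzukiFormula L' R' (k + 1) l).1‖ ≤ N * ε := by
  induction k with
  | zero =>
    refine ⟨1, 4, one_pos, by norm_num, fun n L R L' R' T ε hL hR l hl => ?_⟩
    have hl' : |l / 2| ≤ 1 * T := by
      rw [abs_div, abs_two]; linarith [abs_nonneg l]
    have h1 := hL _ hl'
    have h2 := hR _ hl'
    refine ((norm_mul_sub_mul_le _ _ _ _).trans (add_le_add ((norm_mul_sub_mul_le _ _ _ _).trans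
      (add_le_add ((norm_mul_sub_mul_le _ _ _ _).trans (add_le_add h1 h2)) h2)) h1)).trans_eq ?_
    ring
  | succ k ih =>
    obtain ⟨c, N, hc, hN, ih⟩ := ih
    have hs := suzuki_pos (k + 2) (by omega)
    set s := suzuki (k + 2) with hs_def
    refine ⟨c * (|s| + |1 - 4 * s|), 5 * N, by positivity, by positivity,
      fun n L R L' R' T ε hL hR l hl => ?_⟩
    rw [mul_assoc] at hL hR
    have key (b : ℝ) (hb : |b| ≤ |s| + |1 - 4 * s|) :
        ‖(suzukiFormula L R (k + 1) (b * l)).1 - (suzukiFormula L' R' (k + 1) (b * l)).1‖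
          ≤ N * ε := by
      refine ih n L R L' R' _ ε hL hR (b * l) ?_
      rw [abs_mul]
      gcongr
    have h1 := key s (by linarith [abs_nonneg (1 - 4 * s)])
    have h2 := key (1 - 4 * s) (by linarith [abs_nonneg s])
    refine ((norm_mul_sub_mul_le _ _ _ _).trans (add_le_add ((norm_mul_sub_mul_le _ _ _ _).trans
      (add_le_add ((norm_mul_sub_mul_le _ _ _ _).trans (add_le_add ((norm_mul_sub_mul_le _ _ _ _).trans
      (add_le_add h1 h1)) h2)) h1)) h1)).trans_eq ?_
    ring

end Perturbation

end HybridAdder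

namespace HybridAdder

/-! ### The circuit with exact block encodings -/

section Exact

variable {n : ℕ}

theorem coe_commutatorFormula_skewExp (M N : skewAdjoint (Op n)) (p : ℕ) (t : ℝ) :
    (commutatorFormula (skewExp M) (skewExp N) p t).1 =
      (commutatorFormula (expUnit (M : Op n)) (expUnit (N : Op n)) p t).val := by
  have h := map_commutatorFormula (Unitary.toUnits (R := Op n)) (skewExp M) (skewExp N) p t
  simp only [toUnits_skewExp] at h
  exact congrArg Units.val h

theorem coe_suzukiFormula_skewExp (P Q : skewAdjoint (Op n)) (k : ℕ) (l : ℝ) :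
    (suzukiFormula (skewExp P) (skewExp Q) k l).1 =
      (suzukiFormula (expUnit (P : Op n)) (expUnit (Q : Op n)) k l).val := by
  have h := map_suzukiFormula (Unitary.toUnits (R := Op n)) (skewExp P) (skewExp Q) k l
  simp only [toUnits_skewExp] at h
  exact congrArg Units.val h

/-- The conjugated commutator formula at time `√(l/2)`, run backwards for negative `l`. -/
noncomputable def signedCommutator (u : unitary (Op n)) (M N : skewAdjoint (Op n)) (p : ℕ) (l : ℝ) :
    unitary (Op n) :=
  if 0 ≤ l then u * commutatorFormula (skewExp M) (skewExp N) p √(l / 2) * u⁻¹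
  else (u * commutatorFormula (skewExp M) (skewExp N) p √(-l / 2) * u⁻¹)⁻¹

/-- At time $\sqrt{l/2}$ the formula approximates $\exp(\tfrac l2[M,N])$, whence the
half-commutator. Negative $l$ reduces to positive $l$, inversion being isometric on unitaries. -/
theorem exists_signedCommutator_bound (p : ℕ) :
    ∃ K δ : ℝ, 0 < K ∧ 0 < δ ∧ ∀ (n : ℕ) (u : unitary (Op (n + 1))) (M N : skewAdjoint (Op (n + 1)))
      (C : ℝ), 0 ≤ C → ‖(M : Op (n + 1))‖ ≤ C → ‖(N : Op (n + 1))‖ ≤ C →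
      ∀ l : ℝ, C * √(|l| / 2) < δ →
      ‖(signedCommutator u M N (p + 1) l).1 - (skewExp (conjSkew u (halfCommutator M N)) l).1‖
        ≤ K * (C * √(|l| / 2)) ^ (2 * p + 3) := by
  obtain ⟨K, δ, hK, hδ, h⟩ := exists_commutatorFormula_bound p
  refine ⟨K, δ, hK, hδ, fun n u M N C hC hM hN => ?_⟩
  have key (l : ℝ) (hl : 0 ≤ l) (hlδ : C * √(l / 2) < δ) :
      ‖(u * commutatorFormula (skewExp M) (skewExp N) (p + 1) √(l / 2) * u⁻¹).1
        - (skewExp (conjSkew u (halfCommutator M N)) l).1‖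
        ≤ K * (C * √(l / 2)) ^ (2 * p + 3) := by
    have h1 := h n M N C hC hM hN √(l / 2) (by rwa [abs_of_nonneg (Real.sqrt_nonneg _)])
    rw [abs_of_nonneg (Real.sqrt_nonneg _), Real.sq_sqrt (by positivity)] at h1
    rw [← conj_skewExp, norm_conj_sub_conj, coe_commutatorFormula_skewExp, coe_skewExp]
    convert h1 using 4
    simp only [halfCommutator, smul_smul]
    congr 1
  intro l hl
  unfold signedCommutator
  split_ifs with h0
  · rw [abs_of_nonneg h0] at hl ⊢
    exact key l h0 hl
  · rw [abs_of_neg (not_le.1 h0)] at hl ⊢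
    have := key (-l) (by linarith) hl
    rwa [skewExp_neg, ← norm_inv_sub_inv, inv_inv] at this

/-- The gate `X` as a unitary. -/
noncomputable def unitaryX (n : ℕ) : unitary (Op n) := ⟨qX n, qX_mem_unitary n⟩

/-- The Hadamard gate as a unitary. -/
noncomputable def unitaryH (n : ℕ) : unitary (Op n) := ⟨qH n, qH_mem_unitary n⟩

/-- The phase gate as a unitary. -/
noncomputable def unitaryS (n : ℕ) : unitary (Op n) := ⟨qS n, qS_mem_unitary n⟩

variable (A B : Matrix (Fin n) (Fin n) ℂ)

theorem unitaryX_inv (n : ℕ) : (unitaryX n)⁻¹ = unitaryX n := Subtype.ext (star_qX n)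

theorem unitaryH_inv (n : ℕ) : (unitaryH n)⁻¹ = unitaryH n := Subtype.ext (star_qH n)

theorem prod_exactGate_x_encB (τ : ℝ) :
    (([Gate.x, Gate.encB τ, Gate.x]).map (exactGate A B)).prod =
      skewExp (conjSkew (unitaryX n) (blockGen B)) τ := by
  rw [← conj_skewExp, unitaryX_inv]
  simp [exactGate, unitaryX, mul_assoc]

theorem prod_exactGate_s_encA (τ : ℝ) :
    (([Gate.s, Gate.encA τ, Gate.sdg]).map (exactGate A B)).prod =
      skewExp (conjSkew (unitaryS n) (blockGen A)) τ := by
  rw [← conj_skewExp]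
  simp [exactGate, unitaryS, mul_assoc]

theorem prod_exactGate_encA (τ : ℝ) :
    (([Gate.encA τ]).map (exactGate A B)).prod = skewExp (blockGen A) τ := by
  simp [exactGate]

theorem prod_exactGate_leftCircuit (q : ℕ) (l : ℝ) :
    ((leftCircuit q l).map (exactGate A B)).prod = signedCommutator (unitaryS n * unitaryH n)
      (conjSkew (unitaryX n) (blockGen B)) (blockGen A) q l := by
  have h1 : (([Gate.s, Gate.h]).map (exactGate A B)).prod = unitaryS n * unitaryH n := by
    simp [exactGate, unitaryS, unitaryH]
  have h2 : (([Gate.h, Gate.sdg]).map (exactGate A B)).prod = (unitaryS n * unitaryH n)⁻¹ := by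
    rw [mul_inv_rev, unitaryH_inv]
    simp [exactGate, unitaryS, unitaryH]
  rw [leftCircuit, prod_map_signedFamily (exactGate_inv A B)]
  simp only [List.map_append, List.prod_append, prod_map_bch (exactGate_inv A B), h1, h2,
    prod_exactGate_x_encB, prod_exactGate_encA]
  rfl

theorem prod_exactGate_rightCircuit (q : ℕ) (l : ℝ) :
    ((rightCircuit q l).map (exactGate A B)).prod = signedCommutator (unitaryH n)
      (conjSkew (unitaryS n) (blockGen A)) (conjSkew (unitaryX n) (blockGen B)) q l := by
  have h1 : (([Gate.h]).map (exactGate A B)).prod = unitaryH n := by simp [exactGate, unitaryH]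
  rw [rightCircuit, prod_map_signedFamily (exactGate_inv A B)]
  simp only [List.map_append, List.prod_append, prod_map_bch (exactGate_inv A B), h1,
    prod_exactGate_x_encB, prod_exactGate_s_encA]
  simp only [signedCommutator, unitaryH_inv]

/-- The generator which `Left'` approximates. -/
noncomputable def leftGen : skewAdjoint (Op n) :=
  conjSkew (unitaryS n * unitaryH n)
    (halfCommutator (conjSkew (unitaryX n) (blockGen B)) (blockGen A))

/-- The generator which `Right'` approximates. -/
noncomputable def rightGen : skewAdjoint (Op n) :=
  conjSkew (unitaryH n)
    (halfCommutator (conjSkew (unitaryS n) (blockGen A)) (conjSkew (unitaryX n) (blockGen B)))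

theorem coe_conjSkew_unitaryX_blockGen :
    (conjSkew (unitaryX n) (blockGen B) : Op n) =
      Matrix.fromBlocks 0 (Complex.I • Bᴴ) (Complex.I • B) 0 := by
  simp only [conjSkew, unitaryX, star_qX, coe_blockGen]
  simp [qX, Matrix.fromBlocks_multiply]

theorem coe_conjSkew_unitaryS_blockGen :
    (conjSkew (unitaryS n) (blockGen A) : Op n) = Matrix.fromBlocks 0 A (-Aᴴ) 0 := by
  simp only [conjSkew, unitaryS, star_qS, coe_blockGen]
  simp [qS, Matrix.fromBlocks_multiply, smul_smul]

theorem qH_mul_fromBlocks_mul_qH (D : Matrix (Fin n) (Fin n) ℂ) :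
    qH n * Matrix.fromBlocks D 0 0 (-D) * qH n = Matrix.fromBlocks 0 D D 0 := by
  rw [qH_mul_mul_qH, Matrix.fromBlocks_multiply, Matrix.fromBlocks_multiply, Matrix.fromBlocks_smul]
  simp only [one_mul, mul_one, mul_neg, neg_mul, mul_zero, add_zero, zero_add, neg_neg,
    add_neg_cancel, smul_zero, ← two_smul ℂ D, smul_smul]
  norm_num

/-- The half-commutator is $Z\otimes\tfrac12(AB-(AB)^\dagger)$, commutativity making the lower block
minus the upper one. Conjugation by $H$ turns $Z$ into $X$, and by $S$ turns $X$ into $Y$. -/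
theorem coe_leftGen (hAB : A * B = B * A) :
    (leftGen A B : Op n) = (2⁻¹ : ℝ) • Matrix.fromBlocks 0 (-(Complex.I • (A * B - (A * B)ᴴ)))
      (Complex.I • (A * B - (A * B)ᴴ)) 0 := by
  have h1 : (halfCommutator (conjSkew (unitaryX n) (blockGen B)) (blockGen A) : Op n) =
      (2⁻¹ : ℝ) • Matrix.fromBlocks (A * B - (A * B)ᴴ) 0 0 (-(A * B - (A * B)ᴴ)) := by
    have hAB' : Bᴴ * Aᴴ = Aᴴ * Bᴴ := by
      rw [← Matrix.conjTranspose_mul, ← Matrix.conjTranspose_mul, hAB]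
    simp only [halfCommutator, coe_conjSkew_unitaryX_blockGen, coe_blockGen,
      Matrix.fromBlocks_multiply, Matrix.conjTranspose_mul, hAB']
    rw [sub_eq_add_neg, Matrix.fromBlocks_neg, Matrix.fromBlocks_add]
    simp [smul_smul, hAB, hAB', sub_eq_add_neg, add_comm]
  have h2 : (leftGen A B : Op n) = qS n * (qH n * (halfCommutator (conjSkew (unitaryX n) (blockGen B))
      (blockGen A) : Op n) * qH n) * star (qS n) := by
    simp only [leftGen, conjSkew, Submonoid.coe_mul, unitaryS, unitaryH, star_mul, star_qH, mul_assoc]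
  rw [h2, h1, mul_smul_comm, smul_mul_assoc, qH_mul_fromBlocks_mul_qH, star_qS]
  simp only [mul_smul_comm, smul_mul_assoc, qS, Matrix.fromBlocks_multiply]
  simp

/-- Conjugating the generator of $A$ by $S$ changes the relative sign in the commutator, so the sum
$AB+(AB)^\dagger$ appears in place of the difference. -/
theorem coe_rightGen (hAB : A * B = B * A) :
    (rightGen A B : Op n) = (2⁻¹ : ℝ) • Matrix.fromBlocks 0 (Complex.I • (A * B + (A * B)ᴴ))
      (Complex.I • (A * B + (A * B)ᴴ)) 0 := by
  have hAB' : Bᴴ * Aᴴ = Aᴴ * Bᴴ := by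
    rw [← Matrix.conjTranspose_mul, ← Matrix.conjTranspose_mul, hAB]
  have h1 : (halfCommutator (conjSkew (unitaryS n) (blockGen A))
      (conjSkew (unitaryX n) (blockGen B)) : Op n) =
      (2⁻¹ : ℝ) • Matrix.fromBlocks (Complex.I • (A * B + (A * B)ᴴ)) 0 0
        (-(Complex.I • (A * B + (A * B)ᴴ))) := by
    simp only [halfCommutator, coe_conjSkew_unitaryX_blockGen, coe_conjSkew_unitaryS_blockGen,
      Matrix.fromBlocks_multiply, Matrix.conjTranspose_mul, hAB']
    rw [sub_eq_add_neg, Matrix.fromBlocks_neg, Matrix.fromBlocks_add]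
    simp [hAB, hAB', add_comm]
  have h2 : (rightGen A B : Op n) = qH n * (halfCommutator (conjSkew (unitaryS n) (blockGen A))
      (conjSkew (unitaryX n) (blockGen B)) : Op n) * qH n := by
    simp only [rightGen, conjSkew, unitaryH, star_qH]
  rw [h2, h1, mul_smul_comm, smul_mul_assoc, qH_mul_fromBlocks_mul_qH]

theorem conjSkew_leftGen_add_rightGen (hAB : A * B = B * A) :
    conjSkew (unitaryX n) (leftGen A B + rightGen A B) = blockGen (A * B) := by
  have h : ((leftGen A B + rightGen A B : skewAdjoint (Op n)) : Op n) =
      Matrix.fromBlocks 0 (Complex.I • (A * B)ᴴ) (Complex.I • (A * B)) 0 := by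
    rw [AddSubgroup.coe_add, coe_leftGen A B hAB, coe_rightGen A B hAB, ← smul_add,
      Matrix.fromBlocks_add, Matrix.fromBlocks_smul]
    congr 1
    · simp
    · module
    · module
    · simp
  apply Subtype.ext
  simp only [conjSkew, h, unitaryX, star_qX, coe_blockGen]
  simp [qX, Matrix.fromBlocks_multiply]

end Exact

/-! ### Norms of the generators -/

section Norms

variable {n : ℕ}

theorem norm_one_le_one (n : ℕ) : ‖(1 : Matrix (Fin n) (Fin n) ℂ)‖ ≤ 1 := by
  rw [← Matrix.diagonal_one, Matrix.l2_opNorm_diagonal]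
  exact (pi_norm_le_iff_of_nonneg zero_le_one).2 fun i => by simp

theorem norm_fromBlocks_antidiagonal_le (A B : Matrix (Fin n) (Fin n) ℂ) :
    ‖(Matrix.fromBlocks 0 A B 0 : Op n)‖ ≤ ‖A‖ + ‖B‖ := by
  -- The isometric embeddings of the two summands. The triangle inequality loses a factor $2$, which
  -- is absorbed by the constants.
  let J₁ : Matrix (Fin n ⊕ Fin n) (Fin n) ℂ := Matrix.fromRows 1 0
  let J₂ : Matrix (Fin n ⊕ Fin n) (Fin n) ℂ := Matrix.fromRows 0 1
  have e : (Matrix.fromBlocks 0 A B 0 : Op n) = J₁ * A * J₂ᴴ + J₂ * B * J₁ᴴ := by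
    simp only [J₁, J₂, Matrix.conjTranspose_fromRows_eq_fromCols_conjTranspose,
      Matrix.fromRows_mul]
    ext (i | i) (j | j) <;> simp
  have hJ (J : Matrix (Fin n ⊕ Fin n) (Fin n) ℂ) (h : Jᴴ * J = 1) : ‖J‖ ≤ 1 := by
    have := Matrix.l2_opNorm_conjTranspose_mul_self J
    rw [h] at this
    nlinarith [norm_one_le_one n, norm_nonneg J]
  have h₁ : ‖J₁‖ ≤ 1 := hJ J₁ (by
    simp [J₁, Matrix.conjTranspose_fromRows_eq_fromCols_conjTranspose, Matrix.fromCols_mul_fromRows])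
  have h₂ : ‖J₂‖ ≤ 1 := hJ J₂ (by
    simp [J₂, Matrix.conjTranspose_fromRows_eq_fromCols_conjTranspose, Matrix.fromCols_mul_fromRows])
  have key (J J' : Matrix (Fin n ⊕ Fin n) (Fin n) ℂ) (M : Matrix (Fin n) (Fin n) ℂ)
      (h : ‖J‖ ≤ 1) (h' : ‖J'‖ ≤ 1) : ‖J * M * J'ᴴ‖ ≤ ‖M‖ := by
    calc _ ≤ ‖J * M‖ * ‖J'ᴴ‖ := Matrix.l2_opNorm_mul _ _
      _ ≤ (‖J‖ * ‖M‖) * ‖J'‖ := by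
        rw [Matrix.l2_opNorm_conjTranspose]
        gcongr
        exact Matrix.l2_opNorm_mul _ _
      _ ≤ (1 * ‖M‖) * 1 := by gcongr
      _ = ‖M‖ := by ring
  rw [e]
  exact (norm_add_le _ _).trans (add_le_add (key _ _ _ h₁ h₂) (key _ _ _ h₂ h₁))

theorem norm_blockGen_le (A : Matrix (Fin n) (Fin n) ℂ) : ‖(blockGen A : Op n)‖ ≤ 2 * ‖A‖ := by
  refine (norm_fromBlocks_antidiagonal_le _ _).trans_eq ?_
  rw [norm_smul, norm_smul, Complex.norm_I, Matrix.l2_opNorm_conjTranspose]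
  ring

theorem norm_conjSkew (u : unitary (Op n)) (M : skewAdjoint (Op n)) :
    ‖(conjSkew u M : Op n)‖ = ‖(M : Op n)‖ := by
  change ‖(u : Op n) * M * ((u⁻¹ : unitary (Op n)) : Op n)‖ = _
  rw [CStarRing.norm_mul_coe_unitary, CStarRing.norm_coe_unitary_mul]

theorem norm_halfCommutator_le {M N : skewAdjoint (Op n)} {C : ℝ} (hM : ‖(M : Op n)‖ ≤ C)
    (hN : ‖(N : Op n)‖ ≤ C) : ‖(halfCommutator M N : Op n)‖ ≤ C ^ 2 := by
  have hC : 0 ≤ C := (norm_nonneg _).trans hM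
  have h1 : ‖(M : Op n) * N‖ ≤ C * C := (norm_mul_le _ _).trans (by gcongr)
  have h2 : ‖(N : Op n) * M‖ ≤ C * C := (norm_mul_le _ _).trans (by gcongr)
  have h3 := norm_sub_le ((M : Op n) * N) (N * M)
  simp only [halfCommutator]
  rw [norm_smul, Real.norm_of_nonneg (by norm_num)]
  linarith

end Norms

end HybridAdder

namespace HybridAdder

/-! ### The error of ADD -/

section Main

theorem norm_runFor_sub_skewExp_le {n : ℕ} {U : ℝ → Op (n + 1)}
    (A : Matrix (Fin (n + 1)) (Fin (n + 1)) ℂ) {η s : ℝ} (hη : η ≤ 1 / 2)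
    (h : ‖U |s| - blockEnc A |s|‖ ≤ η) : ‖runFor U s - (skewExp (blockGen A) s).1‖ ≤ 2 * η := by
  rw [blockEnc_eq_skewExp] at h
  unfold runFor
  split_ifs with h0
  · rw [abs_of_nonneg h0] at h
    linarith [(norm_nonneg _).trans h]
  · rw [abs_of_neg (not_le.1 h0)] at h
    have := norm_inv_sub_inv_le _ hη h
    rwa [← skewExp_neg, neg_neg] at this

/-- Replacing the exact block encodings by approximations. -/
theorem norm_evalCircuit_sub_le {n : ℕ} {UA UB : ℝ → Op (n + 1)}
    {A B : Matrix (Fin (n + 1)) (Fin (n + 1)) ℂ} {η a : ℝ} (hη₀ : 0 ≤ η) (hη : η ≤ 1 / 2)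
    (hA : ∀ s, 0 < s → s ≤ a → ‖UA s - blockEnc A s‖ ≤ η)
    (hB : ∀ s, 0 < s → s ≤ a → ‖UB s - blockEnc B s‖ ≤ η)
    {C : Circuit} (hC : ∀ g ∈ C, g.TimeLE a) :
    ‖evalCircuit UA UB C - ((C.map (exactGate A B)).prod).1‖ ≤ 2 ^ C.length * (2 * η) := by
  have h := (norm_prod_map_sub_le (f := fun g => (exactGate A B g).1) (g := Gate.eval UA UB)
    (ε := 2 * η) (by linarith) (by linarith) C
    (fun g _ => (CStarRing.norm_coe_unitary _).le) fun g hg => ?_).1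
  · have e : ((C.map (exactGate A B)).prod).1 = (C.map fun g => (exactGate A B g).1).prod :=
      (map_list_prod (unitary (Op (n + 1))).subtype _).trans (by rw [List.map_map]; rfl)
    rw [e]
    exact h
  · have hg' := hC g hg
    cases g with
    | x => simpa [Gate.eval, exactGate] using hη₀
    | h => simpa [Gate.eval, exactGate] using hη₀
    | s => simpa [Gate.eval, exactGate] using hη₀
    | sdg =>
      have : (exactGate A B Gate.sdg).1 = (qS (n + 1))ᴴ := rfl
      simpa [Gate.eval, this] using hη₀
    | encA τ => exact norm_runFor_sub_skewExp_le A hη (hA _ (abs_pos.2 hg'.1) hg'.2)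
    | encB τ => exact norm_runFor_sub_skewExp_le B hη (hB _ (abs_pos.2 hg'.1) hg'.2)

/-- The choice of $q$: the product formulas, of error $r^{2q+1}$, are no worse than the block
encodings. -/
theorem min_le_two_mul_order_add_one (pA pB : ℝ) : min pA pB ≤ 2 * (order pA pB : ℝ) + 1 := by
  have h1 : (min pA pB - 1) / 2 ≤ ((⌈(min pA pB - 1) / 2⌉₊ : ℕ) : ℝ) := Nat.le_ceil _
  have h2 : ((⌈(min pA pB - 1) / 2⌉₊ : ℕ) : ℝ) ≤ (order pA pB : ℝ) := by
    exact_mod_cast le_max_left _ _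
  linarith

/-- The error of `ADD` with exact block encodings, in terms of `r = C √t`. -/
theorem exists_exact_bound (p : ℕ) : ∃ K ρ : ℝ, 0 < K ∧ 0 < ρ ∧
    ∀ (n : ℕ) (A B : Matrix (Fin (n + 1)) (Fin (n + 1)) ℂ) (C t : ℝ), A * B = B * A →
      ‖A‖ ≤ C → ‖B‖ ≤ C → 0 < t → C * √t ≤ ρ →
      ‖(suzukiFormula
          (signedCommutator (unitaryS _ * unitaryH _) (conjSkew (unitaryX _) (blockGen B))
            (blockGen A) (p + 1))
          (signedCommutator (unitaryH _) (conjSkew (unitaryS _) (blockGen A))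
            (conjSkew (unitaryX _) (blockGen B)) (p + 1)) (p + 1) t).1
        - (skewExp (leftGen A B + rightGen A B) t).1‖ ≤ K * (C * √t) ^ (2 * p + 3) := by
  obtain ⟨K₁, δ₁, hK₁, hδ₁, h₁⟩ := exists_signedCommutator_bound p
  obtain ⟨K₂, δ₂, hK₂, hδ₂, h₂⟩ := exists_suzukiFormula_bound p
  obtain ⟨c, N, hc, hN, h₃⟩ := exists_suzukiFormula_perturbation p
  set a : ℝ := 2 * √(c / 2) with ha_def
  have ha : 0 < a := by positivity
  -- The three thresholds keep $r\le1$, the commutator formulas at $ar<\delta_1$ and the Trotter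
  -- formula at $4r<\delta_2$.
  refine ⟨N * (K₁ * a ^ (2 * p + 3)) + K₂ * 4 ^ (2 * p + 3),
    min 1 (min (δ₁ / (2 * a)) (δ₂ / 8)), by positivity, by positivity,
    fun n A B C t hAB hA hB ht hr => ?_⟩
  obtain ⟨hr1, hr2, hr3⟩ : C * √t ≤ 1 ∧ C * √t ≤ δ₁ / (2 * a) ∧ C * √t ≤ δ₂ / 8 := by
    simpa only [le_min_iff] using hr
  have hC : 0 ≤ C := (norm_nonneg _).trans hA
  have hr0 : 0 ≤ C * √t := by positivity
  have hGA : ‖(blockGen A : Op (n + 1))‖ ≤ 2 * C := (norm_blockGen_le A).trans (by gcongr)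
  have hGB : ‖(blockGen B : Op (n + 1))‖ ≤ 2 * C := (norm_blockGen_le B).trans (by gcongr)
  have hXB := (norm_conjSkew (unitaryX _) (blockGen B)).trans_le hGB
  have hSA := (norm_conjSkew (unitaryS _) (blockGen A)).trans_le hGA
  have hP : ‖(leftGen A B : Op (n + 1))‖ ≤ (2 * C) ^ 2 :=
    (norm_conjSkew _ _).trans_le (norm_halfCommutator_le hXB hGA)
  have hQ : ‖(rightGen A B : Op (n + 1))‖ ≤ (2 * C) ^ 2 :=
    (norm_conjSkew _ _).trans_le (norm_halfCommutator_le hSA hXB)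
  have hτ (l : ℝ) (hl : |l| ≤ c * t) : 2 * C * √(|l| / 2) ≤ a * (C * √t) := by
    have : √(|l| / 2) ≤ √(c / 2) * √t := by
      rw [← Real.sqrt_mul (by positivity)]
      apply Real.sqrt_le_sqrt
      linarith
    calc 2 * C * √(|l| / 2) ≤ 2 * C * (√(c / 2) * √t) := by gcongr
      _ = _ := by rw [ha_def]; ring
  have hδ : a * (C * √t) < δ₁ := by
    calc a * (C * √t) ≤ a * (δ₁ / (2 * a)) := by gcongr
      _ = δ₁ / 2 := by field_simp
      _ < δ₁ := by linarith
  have hstep (u : unitary (Op (n + 1))) (M N : skewAdjoint (Op (n + 1)))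
      (hM : ‖(M : Op (n + 1))‖ ≤ 2 * C) (hN : ‖(N : Op (n + 1))‖ ≤ 2 * C) (l : ℝ)
      (hl : |l| ≤ c * t) :
      ‖(signedCommutator u M N (p + 1) l).1 - (skewExp (conjSkew u (halfCommutator M N)) l).1‖
        ≤ K₁ * (a * (C * √t)) ^ (2 * p + 3) := by
    refine (h₁ n u M N (2 * C) (by positivity) hM hN l ((hτ l hl).trans_lt hδ)).trans ?_
    exact mul_le_mul_of_nonneg_left (pow_le_pow_left₀ (by positivity) (hτ l hl) _) hK₁.le
  have hL := hstep (unitaryS _ * unitaryH _) _ _ hXB hGA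
  have hR := hstep (unitaryH _) _ _ hSA hXB
  have e₁ := h₃ _ _ _ (skewExp (leftGen A B)) (skewExp (rightGen A B)) t _ hL hR t (abs_of_pos ht).le
  have hx : (2 * C) ^ 2 * |t| = 4 * (C * √t) * (C * √t) := by
    rw [abs_of_pos ht]
    nlinarith [Real.mul_self_sqrt ht.le]
  -- The Trotter error is a power of $r^2$; bounding $r^2\le r$ suffices, since the commutator
  -- formulas already cost $r^{2p+3}$.
  have hx' : (2 * C) ^ 2 * |t| ≤ 4 * (C * √t) := by
    rw [hx]
    exact mul_le_of_le_one_right (by positivity) hr1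
  have e₂ := h₂ n _ _ ((2 * C) ^ 2) (by positivity) hP hQ t (by linarith)
  have e₂' : K₂ * ((2 * C) ^ 2 * |t|) ^ (2 * p + 3) ≤ K₂ * (4 * (C * √t)) ^ (2 * p + 3) := by
    gcongr
  rw [← coe_suzukiFormula_skewExp] at e₂
  have e₃ := norm_add_le_of_le e₁ (e₂.trans e₂')
  rw [sub_add_sub_cancel] at e₃
  refine e₃.trans_eq ?_
  rw [mul_pow, mul_pow]
  ring

theorem prod_exactGate_addCircuit {n : ℕ} (A B : Matrix (Fin n) (Fin n) ℂ) {pA pB : ℝ} {q : ℕ}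
    (hq : order pA pB = q) (t : ℝ) :
    ((addCircuit pA pB t).map (exactGate A B)).prod = unitaryX _ * suzukiFormula
      (signedCommutator (unitaryS _ * unitaryH _) (conjSkew (unitaryX _) (blockGen B))
        (blockGen A) q)
      (signedCommutator (unitaryH _) (conjSkew (unitaryS _) (blockGen A))
        (conjSkew (unitaryX _) (blockGen B)) q) q t * (unitaryX _)⁻¹ := by
  have hx : (([Gate.x]).map (exactGate A B)).prod = unitaryX n := by
    simp [exactGate, unitaryX]
  simp only [addCircuit, hq, List.map_append, List.prod_append, prod_map_trotter,
    prod_exactGate_leftCircuit, prod_exactGate_rightCircuit, hx, unitaryX_inv]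

theorem exp_eq_conj_skewExp {n : ℕ} {A B : Matrix (Fin n) (Fin n) ℂ} (hAB : A * B = B * A)
    (t : ℝ) : NormedSpace.exp ((Complex.I * (t : ℂ)) •
      (Matrix.fromBlocks 0 (A * B) (A * B)ᴴ 0 : Op n)) =
      (unitaryX _ * skewExp (leftGen A B + rightGen A B) t * (unitaryX _)⁻¹).1 := by
  rw [conj_skewExp, conjSkew_leftGen_add_rightGen A B hAB, I_mul_smul_fromBlocks]
  rfl

theorem rpow_min_le {pA pB p x y : ℝ} (hm : 0 ≤ min pA pB) (hp : min pA pB ≤ p) (hx : 0 ≤ x)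
    (hxy : x ≤ y) (hy : y ≤ 1) : x ^ p ≤ y ^ min pA pB :=
  (Real.rpow_le_rpow hx hxy (hm.trans hp)).trans
    (Real.rpow_le_rpow_of_exponent_ge' (hx.trans hxy) hy hm hp)

set_option maxHeartbeats 800000 in
theorem exists_addCircuit_bound (pA pB : ℝ) (hpA : 1 ≤ pA) (hpB : 1 ≤ pB) (K : ℝ) :
    ∃ K' κ : ℝ, 0 < K' ∧ 0 < κ ∧
      ∀ (n : ℕ) (A B : Matrix (Fin n) (Fin n) ℂ) (c t₀ : ℝ) (UA UB : ℝ → Op n),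
        A * B = B * A → 0 ≤ c → 0 < t₀ →
        (∀ t : ℝ, 0 < t → t ≤ t₀ → ‖UA t - blockEnc A t‖ ≤ K * (c * t) ^ pA) →
        (∀ t : ℝ, 0 < t → t ≤ t₀ → ‖UB t - blockEnc B t‖ ≤ K * (c * t) ^ pB) →
        ∀ t : ℝ, 0 < t → t ≤ κ * t₀ ^ 2 → cTotal A B c * t ≤ κ →
          ‖evalCircuit UA UB (addCircuit pA pB t)
              - NormedSpace.exp ((Complex.I * (t : ℂ)) •
                  (Matrix.fromBlocks 0 (A * B) (A * B)ᴴ 0 : Op n))‖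
            ≤ K' * (cTotal A B c * t) ^ (min pA pB / 2) := by
  obtain ⟨p, hp⟩ := exists_order_eq pA pB
  obtain ⟨Γ, hΓ, hΓt⟩ := exists_timeLE_addCircuit pA pB
  obtain ⟨len, hlen⟩ := exists_length_addCircuit pA pB
  obtain ⟨K₁, ρ₁, hK₁, hρ₁, h₁⟩ := exists_exact_bound p
  set m := min pA pB with hm_def
  have hm : 1 ≤ m := le_min hpA hpB
  have hmp : m ≤ ((2 * p + 3 : ℕ) : ℝ) := by
    have := min_le_two_mul_order_add_one pA pB
    rw [hp] at this
    push_cast at this ⊢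
    linarith
  -- With $r\le\rho$: the bound with exact encodings applies, $\Gamma r\le1$ lets exponents be
  -- lowered to $m$, and $|K|\Gamma r\le1/2$ keeps the gates invertible. Taking $\kappa=\rho^2$
  -- turns conditions on $t$ into conditions on $\sqrt t$.
  set ρ : ℝ := min (min 1 ρ₁) (min (1 / Γ) (1 / (2 * (|K| + 1) * Γ))) with hρ_def
  have hρ : 0 < ρ := by positivity
  refine ⟨2 ^ len * (2 * (|K| * Γ ^ m)) + K₁, ρ ^ 2, by positivity, by positivity,
    fun n A B c t₀ UA UB hAB hc ht₀ hA hB t ht htt₀ htκ => ?_⟩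
  cases n with
  -- In dimension $0$ the identity has norm $0$, so the uniform bounds are stated for `n + 1`; here
  -- all operators coincide.
  | zero =>
    have hT : 0 ≤ cTotal A B c := (norm_nonneg _).trans (le_max_left _ _)
    rw [Subsingleton.elim (evalCircuit UA UB (addCircuit pA pB t) - _) 0, norm_zero]
    positivity
  | succ n =>
    set C := cBCH A B c with hC_def
    have hCA : ‖A‖ ≤ C := le_max_left _ _
    have hCB : ‖B‖ ≤ C := (le_max_left _ _).trans (le_max_right _ _)
    have hCc : c ≤ C := (le_max_right _ _).trans (le_max_right _ _)
    have hC : 0 ≤ C := hc.trans hCc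
    have hCT : C ^ 2 ≤ cTotal A B c := (le_max_right _ _).trans (le_max_right _ _)
    set r := C * √t with hr_def
    have hr0 : 0 ≤ r := by positivity
    have hr2 : r ^ 2 = C ^ 2 * t := by rw [hr_def, mul_pow, Real.sq_sqrt ht.le]
    have hr2' : r ^ 2 ≤ cTotal A B c * t := by rw [hr2]; gcongr
    have hrρ : r ≤ ρ := le_of_sq_le_sq (hr2'.trans htκ) hρ.le
    obtain ⟨⟨hr1, hrρ₁⟩, hrΓ, hrK⟩ :
        (r ≤ 1 ∧ r ≤ ρ₁) ∧ r ≤ 1 / Γ ∧ r ≤ 1 / (2 * (|K| + 1) * Γ) := by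
      simpa only [hρ_def, le_min_iff] using hrρ
    have hΓr : Γ * r ≤ 1 := by rwa [le_div_iff₀' hΓ] at hrΓ
    have hΓt₀ : Γ * √t ≤ t₀ := by
      have h1 : √t ≤ ρ * t₀ := by
        rw [Real.sqrt_le_left (by positivity), mul_pow]
        exact htt₀
      have h2 : ρ ≤ 1 / Γ := (min_le_right _ _).trans (min_le_left _ _)
      calc Γ * √t ≤ Γ * (1 / Γ * t₀) := by gcongr; exact h1.trans (by gcongr)
        _ = t₀ := by field_simp
    have hη : |K| * (Γ * r) ^ m ≤ 1 / 2 := by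
      have h1 : (Γ * r) ^ m ≤ Γ * r := by
        simpa using Real.rpow_le_rpow_of_exponent_ge' (by positivity) hΓr zero_le_one hm
      rw [le_div_iff₀ (by positivity)] at hrK
      nlinarith [abs_nonneg K, mul_nonneg hΓ.le hr0, mul_le_mul_of_nonneg_left h1 (abs_nonneg K)]
    have hgate (U : ℝ → Op (n + 1)) (D : Matrix (Fin (n + 1)) (Fin (n + 1)) ℂ) (q : ℝ) (hq : m ≤ q)
        (h : ∀ t : ℝ, 0 < t → t ≤ t₀ → ‖U t - blockEnc D t‖ ≤ K * (c * t) ^ q) (s : ℝ)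
        (hs : 0 < s) (hs' : s ≤ Γ * √t) : ‖U s - blockEnc D s‖ ≤ |K| * (Γ * r) ^ m := by
      have h1 : c * s ≤ Γ * r :=
        (mul_le_mul hCc hs' hs.le hC).trans_eq (mul_left_comm _ _ _)
      have h2 := rpow_min_le (pA := pA) (pB := pB) (by linarith) hq (by positivity) h1 hΓr
      exact (h s hs (hs'.trans hΓt₀)).trans
        (mul_le_mul (le_abs_self K) h2 (by positivity) (abs_nonneg K))
    have hη₀ : 0 ≤ |K| * (Γ * r) ^ m := by positivity
    have e₁ := norm_evalCircuit_sub_le (a := Γ * √t) hη₀ hη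
      (hgate UA A pA (min_le_left _ _) hA) (hgate UB B pB (min_le_right _ _) hB) (hΓt t ht)
    have hexact := prod_exactGate_addCircuit A B hp t
    have htarget := exp_eq_conj_skewExp hAB t
    have e₂ := h₁ n A B C t hAB hCA hCB ht hrρ₁
    -- The outer `X` gates are an isometric conjugation, carrying the sum of the two generators to
    -- the target.
    rw [← norm_conj_sub_conj (unitaryX _), ← hexact, ← htarget] at e₂
    have e₃ := norm_add_le_of_le e₁ e₂
    rw [sub_add_sub_cancel, hlen] at e₃
    have hrm : r ^ m ≤ (cTotal A B c * t) ^ (m / 2) := by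
      calc r ^ m = (r ^ 2) ^ (m / 2) := by
            rw [← Real.rpow_natCast, ← Real.rpow_mul hr0]
            congr 1
            push_cast
            ring
        _ ≤ _ := Real.rpow_le_rpow (by positivity) hr2' (by linarith)
    have hrp : r ^ (2 * p + 3) ≤ r ^ m := by
      rw [← Real.rpow_natCast]
      exact Real.rpow_le_rpow_of_exponent_ge' hr0 hr1 (by linarith) hmp
    calc _ ≤ 2 ^ len * (2 * (|K| * (Γ * r) ^ m)) + K₁ * r ^ (2 * p + 3) := e₃
      _ = 2 ^ len * (2 * (|K| * Γ ^ m)) * r ^ m + K₁ * r ^ (2 * p + 3) := by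
        rw [Real.mul_rpow hΓ.le hr0]; ring
      _ ≤ 2 ^ len * (2 * (|K| * Γ ^ m)) * r ^ m + K₁ * r ^ m := by gcongr
      _ = (2 ^ len * (2 * (|K| * Γ ^ m)) + K₁) * r ^ m := by ring
      _ ≤ _ := by gcongr

end Main

end HybridAdder

theorem mainTheorem4 (pA pB : ℝ) (hpA : 1 ≤ pA) (hpB : 1 ≤ pB) :
    (∀ t : ℝ, 0 < t →
      (HybridAdder.numExponentials (HybridAdder.addCircuit pA pB t) : ℝ)
        ≤ 1.07 * 30 ^ HybridAdder.order pA pB) ∧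
    ∀ K : ℝ, ∃ K' κ : ℝ, 0 < K' ∧ 0 < κ ∧
      ∀ (n : ℕ) (A B : Matrix (Fin n) (Fin n) ℂ) (c t₀ : ℝ) (UA UB : ℝ → HybridAdder.Op n),
        A * B = B * A → 0 ≤ c → 0 < t₀ →
        (∀ t : ℝ, 0 < t → t ≤ t₀ → ‖UA t - HybridAdder.blockEnc A t‖ ≤ K * (c * t) ^ pA) →
        (∀ t : ℝ, 0 < t → t ≤ t₀ → ‖UB t - HybridAdder.blockEnc B t‖ ≤ K * (c * t) ^ pB) →
        ∀ t : ℝ, 0 < t → t ≤ κ * t₀ ^ 2 → HybridAdder.cTotal A B c * t ≤ κ →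
          ‖HybridAdder.evalCircuit UA UB (HybridAdder.addCircuit pA pB t)
              - NormedSpace.exp ((Complex.I * (t : ℂ)) •
                  (Matrix.fromBlocks 0 (A * B) (A * B)ᴴ 0 : HybridAdder.Op n))‖
            ≤ K' * (HybridAdder.cTotal A B c * t) ^ (min pA pB / 2) :=
  ⟨fun t _ => HybridAdder.numExponentials_addCircuit pA pB t,
    HybridAdder.exists_addCircuit_bound pA pB hpA hpB⟩
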